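/- Let $(G,H,\sigma)$ be a reduced $1$-dimensional Hecke triple: $G$ is a group, $H$ a subgroup with $[H:H\cap xHx^{-1}]<\infty$ for all $x\in G$, $\sigma:H\to\mathbb T$ a character (one-dimensional unitary representation) with finite range, and, with $K=\ker\sigma$, $\bigcap_{x\in G}xKx^{-1}=\{e\}$. Let $G_\sigma$ be the Schlichting completion of the pair $(G,K)$, that is, the closure of the image of $G$ in the group of permutations of $G/K$ with the topology of pointwise convergence (which induces on $G$ the Hecke topology with neighbourhood subbase $\{xKx^{-1}\mid x\in G\}$ at $e$). Let $H_\sigma$ be the closure of $H$ in $G_\sigma$, a compact open subgroup, and denote again by $\sigma$ the unique continuous extension of $\sigma$ to a character of $H_\sigma$. Let $B=\{x\in G\mid \sigma(h)=\sigma(x^{-1}hx)\text{ for all }h\in H\cap xHx^{-1}\}$ and assume that $B$ is a subgroup of $G$. Let $B_\sigma$ be the closure of $B$ in $G_\sigma$. Then $$B_\sigma=\{x\in G_\sigma\mid \sigma(h)=\sigma(x^{-1}hx)\text{ for all }h\in H_\sigma\cap xH_\sigma x^{-1}\},$$ and the generalised Hecke algebra $\mathcal H_\sigma(G,H)$ is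 isomorphic, as a complex $*$-algebra, to the corner $p_\sigma C_c(B_\sigma)p_\sigma$. Here $\mathcal H_\sigma(G,H)$ is the space of functions $f:G\to\mathbb C$ with finite support in $H\backslash G/H$ such that $f(hxk)=\sigma(h)f(x)\sigma(k)$ for all $h,k\in H$, $x\in G$, with product $(f*g)(x)=\sum_{yH\in G/H}f(y)g(y^{-1}x)$ and involution $f^*(x)=\Delta_K(x^{-1})\overline{f(x^{-1})}$, where $\Delta_K(x)=[K:K\cap xKx^{-1}]/[K:K\cap x^{-1}Kx]$. The space $C_c(B_\sigma)$ of continuous compactly supported functions $B_\sigma\to\mathbb C$ carries the convolution $(f*g)(x)=\int_{B_\sigma} f(y)g(y^{-1}x)\,d\mu(y)$ with respect to the left Haar measure $\mu$ on $B_\sigma$ with $\mu(H_\sigma)=1$, and the involution $f^*(x)=\Delta(x^{-1})\overline{f(x^{-1})}$, where $\Delta$ is the modular function of $B_\sigma$, normalised by $\mu(Ax)=\Delta(x)\mu(A)$. Finally $p_\sigma\in C_c(B_\sigma)$ is the self-adjoint projection equal to $\sigma$ on $H_\sigma$ and to $0$ elsewhere, and $p_\sigma C_c(B_\sigma)p_\sigma=\{p_\sigma*a*p_\sigma\mid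 a\in C_c(B_\sigma)\}$. -/

import Mathlib

open MeasureTheory Topology
open scoped CompactlySupported NNReal Pointwise

set_option linter.unusedSectionVars false

section ConvolutionAlgebra

/-- `C_c(L)`, the space of continuous compactly supported functions `L → ℂ`, regarded as a
convolution algebra with respect to the measure `μ` on the group `L`. -/
def ConvAlg {L : Type*} [TopologicalSpace L] [MeasurableSpace L] (_μ : Measure L) : Type _ :=
  C_c(L, ℂ)

namespace ConvAlg

section Basic

variable {L : Type*} [TopologicalSpace L] [MeasurableSpace L] {μ : Measure L}

noncomputable instance : AddCommGroup (ConvAlg μ) := inferInstanceAs (AddCommGroup C_c(L, ℂ))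

noncomputable instance : Module ℂ (ConvAlg μ) := inferInstanceAs (Module ℂ C_c(L, ℂ))

instance : FunLike (ConvAlg μ) L ℂ := inferInstanceAs (FunLike C_c(L, ℂ) L ℂ)

theorem ext {f g : ConvAlg μ} (h : ∀ x, f x = g x) : f = g := DFunLike.ext f g h

theorem add_apply (f g : ConvAlg μ) (x : L) : (f + g) x = f x + g x := rfl

theorem zero_apply (x : L) : (0 : ConvAlg μ) x = 0 := rfl

theorem smul_apply (c : ℂ) (f : ConvAlg μ) (x : L) : (c • f) x = c * f x := rfl

theorem continuous (f : ConvAlg μ) : Continuous f :=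
  (CompactlySupportedContinuousMap.toContinuousMap f).continuous

theorem hasCompactSupport (f : ConvAlg μ) : HasCompactSupport f :=
  CompactlySupportedContinuousMap.hasCompactSupport (α := L) (β := ℂ) f

end Basic

variable {L : Type*} [TopologicalSpace L] [Group L] [IsTopologicalGroup L] [LocallyCompactSpace L]
  [MeasurableSpace L] [BorelSpace L] {μ : Measure L}

theorem continuous_conv [IsFiniteMeasureOnCompacts μ] (f g : ConvAlg μ) :
    Continuous fun x => ∫ y, f y * g (y⁻¹ * x) ∂μ := by
  rw [← continuousOn_univ]
  refine continuousOn_integral_of_compact_support (k := tsupport f) f.hasCompactSupport ?_ ?_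
  · refine Continuous.continuousOn ?_
    exact (f.continuous.comp continuous_snd).mul
      (g.continuous.comp (continuous_snd.inv.mul continuous_fst))
  · intro p x _ hx
    rw [image_eq_zero_of_notMem_tsupport hx, zero_mul]

theorem hasCompactSupport_conv (f g : ConvAlg μ) :
    HasCompactSupport fun x => ∫ y, f y * g (y⁻¹ * x) ∂μ := by
  refine HasCompactSupport.intro (K := tsupport f * tsupport g)
    (f.hasCompactSupport.isCompact.mul g.hasCompactSupport.isCompact) ?_
  intro x hx
  have : ∀ y, f y * g (y⁻¹ * x) = 0 := by
    intro y
    by_cases hy : y ∈ tsupport f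
    · have : y⁻¹ * x ∉ tsupport g := fun h => hx ⟨y, hy, _, h, by simp⟩
      rw [image_eq_zero_of_notMem_tsupport this, mul_zero]
    · rw [image_eq_zero_of_notMem_tsupport hy, zero_mul]
  simp [this]

/-- The convolution product `(f * g)(x) = ∫ f(y) g(y⁻¹ x) dμ(y)`. -/
noncomputable instance [IsFiniteMeasureOnCompacts μ] : Mul (ConvAlg μ) where
  mul f g := CompactlySupportedContinuousMap.mk
    ⟨fun x => ∫ y, f y * g (y⁻¹ * x) ∂μ, continuous_conv f g⟩ (hasCompactSupport_conv f g)

theorem mul_apply [IsFiniteMeasureOnCompacts μ] (f g : ConvAlg μ) (x : L) :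
    (f * g) x = ∫ y, f y * g (y⁻¹ * x) ∂μ := rfl

theorem integrable_conv [IsFiniteMeasureOnCompacts μ] (f g : ConvAlg μ) (x : L) :
    Integrable (fun y => f y * g (y⁻¹ * x)) μ :=
  Continuous.integrable_of_hasCompactSupport
    (f.continuous.mul (g.continuous.comp (continuous_inv.mul continuous_const)))
    f.hasCompactSupport.mul_right

theorem mul_assoc' [μ.IsHaarMeasure] (f g k : ConvAlg μ) : f * g * k = f * (g * k) := by
  refine ext fun x => ?_
  have h1 : ∀ y, f y * (g * k) (y⁻¹ * x) = ∫ z, f y * (g (y⁻¹ * z) * k (z⁻¹ * x)) ∂μ := by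
    intro y
    rw [mul_apply, ← integral_const_mul,
      ← integral_mul_left_eq_self (fun z => f y * (g (y⁻¹ * z) * k (z⁻¹ * x))) y]
    simp [mul_assoc]
  have h2 : ∀ z, (f * g) z * k (z⁻¹ * x) = ∫ y, f y * (g (y⁻¹ * z) * k (z⁻¹ * x)) ∂μ := by
    intro z
    rw [mul_apply, ← integral_mul_const]
    simp [mul_assoc]
  rw [mul_apply, mul_apply]
  simp_rw [h1, h2]
  refine integral_integral_swap_of_hasCompactSupport
    (f := fun z y => f y * (g (y⁻¹ * z) * k (z⁻¹ * x))) ?_ ?_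
  · refine (f.continuous.comp continuous_snd).mul
      ((g.continuous.comp (continuous_snd.inv.mul continuous_fst)).mul
        (k.continuous.comp (continuous_fst.inv.mul continuous_const)))
  · refine HasCompactSupport.intro (K := (tsupport f * tsupport g) ×ˢ tsupport f)
      ((f.hasCompactSupport.isCompact.mul g.hasCompactSupport.isCompact).prod
        f.hasCompactSupport.isCompact) ?_
    rintro ⟨z, y⟩ hzy
    change f y * (g (y⁻¹ * z) * k (z⁻¹ * x)) = 0
    by_cases hy : y ∈ tsupport f
    · have : y⁻¹ * z ∉ tsupport g := fun h => hzy ⟨⟨y, hy, _, h, by simp⟩, hy⟩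
      rw [image_eq_zero_of_notMem_tsupport this, zero_mul, mul_zero]
    · rw [image_eq_zero_of_notMem_tsupport hy, zero_mul]

noncomputable instance [μ.IsHaarMeasure] : NonUnitalRing (ConvAlg μ) where
  left_distrib f g k := by
    refine ext fun x => ?_
    rw [add_apply, mul_apply, mul_apply, mul_apply,
      ← integral_add (integrable_conv f g x) (integrable_conv f k x)]
    simp [add_apply, mul_add]
  right_distrib f g k := by
    refine ext fun x => ?_
    rw [add_apply, mul_apply, mul_apply, mul_apply,
      ← integral_add (integrable_conv f k x) (integrable_conv g k x)]
    simp [add_apply, add_mul]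
  zero_mul f := ext fun x => by simp [mul_apply, zero_apply]
  mul_zero f := ext fun x => by simp [mul_apply, zero_apply]
  mul_assoc := mul_assoc'

instance [μ.IsHaarMeasure] : IsScalarTower ℂ (ConvAlg μ) (ConvAlg μ) where
  smul_assoc c f g := ext fun x => by
    simp only [smul_eq_mul, smul_apply, mul_apply, ← integral_const_mul, mul_assoc]

instance [μ.IsHaarMeasure] : SMulCommClass ℂ (ConvAlg μ) (ConvAlg μ) where
  smul_comm c f g := ext fun x => by
    simp only [smul_eq_mul, smul_apply, mul_apply, ← integral_const_mul, mul_left_comm]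

end ConvAlg

/-- The modular function `Δ` of a locally compact group `L`, normalised by
`μ (A x) = Δ x * μ A` for left Haar measures `μ`. (Mathlib's `modularCharacter` is
`x ↦ μ (A x⁻¹) / μ A`.) -/
noncomputable def modularFun {L : Type*} [TopologicalSpace L] [Group L] [IsTopologicalGroup L]
    [LocallyCompactSpace L] (x : L) : ℝ := (Measure.modularCharacter x⁻¹ : ℝ≥0)

theorem modularFun_mul {L : Type*} [TopologicalSpace L] [Group L] [IsTopologicalGroup L]
    [LocallyCompactSpace L] (x y : L) : modularFun (x * y) = modularFun x * modularFun y := by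
  simp [modularFun, mul_comm]

theorem modularFun_one {L : Type*} [TopologicalSpace L] [Group L] [IsTopologicalGroup L]
    [LocallyCompactSpace L] : modularFun (1 : L) = 1 := by
  simp [modularFun]

theorem continuous_modularFun {L : Type*} [TopologicalSpace L] [Group L] [IsTopologicalGroup L]
    [LocallyCompactSpace L] : Continuous (modularFun : L → ℝ) := by
  borelize L
  let μ : Measure L := Measure.haar
  obtain ⟨⟨f, f_cont⟩, f_comp, f_nonneg, f_one⟩ :
    ∃ f : C(L, ℝ), HasCompactSupport f ∧ 0 ≤ f ∧ f 1 ≠ 0 := exists_continuous_nonneg_pos 1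
  have hne : ∫ x, f x ∂μ ≠ 0 :=
    ne_of_gt (f_cont.integral_pos_of_hasCompactSupport_nonneg_nonzero f_comp f_nonneg f_one)
  have key : ∀ g : L, modularFun g = (∫ x, f (x * g⁻¹) ∂μ) / ∫ x, f x ∂μ := by
    intro g
    change ((Measure.modularCharacterFun g⁻¹ : ℝ≥0) : ℝ) = _
    rw [Measure.modularCharacterFun_eq_haarScalarFactor μ,
      Measure.haarScalarFactor_eq_integral_div _ _ f_cont f_comp hne,
      integral_map (AEMeasurable.mul_const aemeasurable_id' _)
        (Continuous.aestronglyMeasurable f_cont)]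
  have : Continuous fun g : L => ∫ x, f (x * g⁻¹) ∂μ := by
    rw [continuous_iff_continuousAt]
    intro g₀
    obtain ⟨t, ht, hg₀⟩ := exists_compact_mem_nhds g₀
    refine ContinuousOn.continuousAt (s := t) ?_ hg₀
    refine continuousOn_integral_of_compact_support (k := tsupport f * t)
      (f_comp.isCompact.mul ht) ?_ ?_
    · exact (f_cont.comp (continuous_snd.mul continuous_fst.inv)).continuousOn
    · intro p x hp hx
      refine image_eq_zero_of_notMem_tsupport fun h => hx ⟨_, h, p, hp, by simp⟩
  simpa only [funext key] using this.div_const _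

namespace ConvAlg

variable {L : Type*} [TopologicalSpace L] [Group L] [IsTopologicalGroup L] [LocallyCompactSpace L]
  [MeasurableSpace L] [BorelSpace L] {μ : Measure L}

/-- The involution `f^*(x) = Δ(x⁻¹) * conj (f (x⁻¹))`. -/
noncomputable instance : Star (ConvAlg μ) where
  star f := CompactlySupportedContinuousMap.mk
    ⟨fun x => (modularFun x⁻¹ : ℂ) * star (f x⁻¹),
      (Complex.continuous_ofReal.comp (continuous_modularFun.comp continuous_inv)).mul
        (continuous_star.comp (f.continuous.comp continuous_inv))⟩
    (by
      refine HasCompactSupport.mul_left ?_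
      exact (f.hasCompactSupport.comp_homeomorph (Homeomorph.inv L)).comp_left (star_zero ℂ))

theorem star_apply (f : ConvAlg μ) (x : L) :
    (star f) x = (modularFun x⁻¹ : ℂ) * star (f x⁻¹) := rfl

noncomputable instance [μ.IsHaarMeasure] : StarRing (ConvAlg μ) where
  star_involutive f := ext fun x => by
    rw [star_apply, star_apply]
    simp only [inv_inv, star_mul', RCLike.star_def, Complex.conj_ofReal]
    rw [← mul_assoc, ← Complex.ofReal_mul, ← modularFun_mul]
    simp [modularFun_one]
  star_add f g := ext fun x => by
    simp only [star_apply, add_apply, star_add, mul_add]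
  star_mul f g := ext fun x => by
    rw [star_apply, mul_apply, mul_apply,
      ← integral_mul_left_eq_self (fun y => star g y * star f (y⁻¹ * x)) x,
      RCLike.star_def, ← integral_conj, ← integral_const_mul]
    refine integral_congr_ae (Filter.Eventually.of_forall fun y => ?_)
    simp only [star_apply, mul_inv_rev, inv_inv, inv_mul_cancel_right, map_mul, RCLike.star_def]
    have : modularFun x⁻¹ = modularFun (y⁻¹ * x⁻¹) * modularFun y := by
      simp only [modularFun_mul]
      have h := modularFun_mul y⁻¹ y
      rw [inv_mul_cancel, modularFun_one] at h
      linear_combination modularFun x⁻¹ * h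
    rw [this]
    push_cast
    ring

instance [μ.IsHaarMeasure] : StarModule ℂ (ConvAlg μ) where
  star_smul c f := ext fun x => by
    simp only [star_apply, smul_apply, star_mul']
    ring

end ConvAlg

/-- The corner `p A p = {p a p | a ∈ A}` of a `*`-algebra `A` determined by a projection `p`. -/
def starCorner {A : Type*} [NonUnitalRing A] [StarRing A] [Module ℂ A] [IsScalarTower ℂ A A]
    [SMulCommClass ℂ A A] [StarModule ℂ A] (p : A) (hp : IsStarProjection p) :
    NonUnitalStarSubalgebra ℂ A where
  carrier := {b | ∃ a, b = p * a * p}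
  add_mem' := by
    rintro _ _ ⟨a, rfl⟩ ⟨b, rfl⟩
    exact ⟨a + b, by rw [mul_add, add_mul]⟩
  zero_mem' := ⟨0, by simp⟩
  mul_mem' := by
    rintro _ _ ⟨a, rfl⟩ ⟨b, rfl⟩
    exact ⟨a * p * (p * b), by simp only [mul_assoc]⟩
  smul_mem' := by
    rintro c _ ⟨a, rfl⟩
    exact ⟨c • a, by simp only [mul_smul_comm, smul_mul_assoc]⟩
  star_mem' := by
    rintro _ ⟨a, rfl⟩
    exact ⟨star a, by simp only [star_mul, hp.isSelfAdjoint.star_eq, mul_assoc]⟩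

end ConvolutionAlgebra

section PermutationTopology

variable {α : Type*}

/-- The topology of pointwise convergence on the group of permutations of a discrete set. -/
instance permTopology : TopologicalSpace (Equiv.Perm α) :=
  TopologicalSpace.induced (fun (g : Equiv.Perm α) (a : α) => g a)
    (@Pi.topologicalSpace α (fun _ => α) fun _ => ⊥)

theorem isOpen_perm_eval (a b : α) : IsOpen {g : Equiv.Perm α | g a = b} := by
  let _ : TopologicalSpace α := ⊥
  have _ : DiscreteTopology α := ⟨rfl⟩
  have h : Continuous fun g : Equiv.Perm α => g a :=
    (continuous_apply a).comp (continuous_induced_dom (f := fun (g : Equiv.Perm α) (a : α) => g a))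
  exact (isOpen_discrete {b}).preimage h

theorem continuous_to_perm {X : Type*} [TopologicalSpace X] {f : X → Equiv.Perm α}
    (h : ∀ a b, IsOpen {x | f x a = b}) : Continuous f := by
  let _ : TopologicalSpace α := ⊥
  have _ : DiscreteTopology α := ⟨rfl⟩
  refine continuous_induced_rng.2 (continuous_pi fun a => ?_)
  exact continuous_discrete_rng.2 fun b => h a b

instance : IsTopologicalGroup (Equiv.Perm α) where
  continuous_mul := by
    refine continuous_to_perm fun a b => ?_
    have : {x : Equiv.Perm α × Equiv.Perm α | (x.1 * x.2) a = b} =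
        ⋃ c, {g | g c = b} ×ˢ {g | g a = c} := by
      ext x; simp
    rw [this]
    exact isOpen_iUnion fun c => (isOpen_perm_eval c b).prod (isOpen_perm_eval a c)
  continuous_inv := by
    refine continuous_to_perm fun a b => ?_
    have : {x : Equiv.Perm α | x⁻¹ a = b} = {g | g b = a} := by
      ext x; exact Equiv.Perm.inv_eq_iff_eq.trans eq_comm
    rw [this]
    exact isOpen_perm_eval b a

noncomputable instance : MeasurableSpace (Equiv.Perm α) := borel _

instance : BorelSpace (Equiv.Perm α) := ⟨rfl⟩

/-- A closed set of permutations that moves every point, forwards and backwards, inside a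
finite set is compact. -/
theorem isCompact_of_finite_orbits {S : Set (Equiv.Perm α)} (hS : IsClosed S) (t : α → Set α)
    (ht : ∀ a, (t a).Finite) (h : ∀ g ∈ S, ∀ a, g a ∈ t a ∧ g⁻¹ a ∈ t a) : IsCompact S := by
  let _ : TopologicalSpace α := ⊥
  have _ : DiscreteTopology α := ⟨rfl⟩
  let e : Equiv.Perm α → (α → α) × (α → α) := fun g => (fun a => g a, fun a => g⁻¹ a)
  have hind : IsInducing fun (g : Equiv.Perm α) (a : α) => g a := ⟨rfl⟩
  have he : IsClosedEmbedding e := by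
    refine ⟨⟨IsInducing.of_comp ?_ continuous_fst hind, ?_⟩, ?_⟩
    · exact hind.continuous.prodMk (hind.continuous.comp continuous_inv)
    · intro g g' hgg
      exact Equiv.ext fun a => congrFun (congrArg Prod.fst hgg) a
    · have : Set.range e = ⋂ a, {p | p.1 (p.2 a) = a} ∩ {p | p.2 (p.1 a) = a} := by
        ext p
        simp only [Set.mem_range, Set.mem_iInter, Set.mem_inter_iff, Set.mem_ofPred_eq]
        constructor
        · rintro ⟨g, rfl⟩ a
          simp [e]
        · intro hp
          exact ⟨⟨p.1, p.2, fun a => (hp a).2, fun a => (hp a).1⟩, rfl⟩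
      rw [this]
      have hev : Continuous fun q : (α → α) × α => q.1 q.2 := by
        rw [continuous_discrete_rng]
        intro b
        have : (fun q : (α → α) × α => q.1 q.2) ⁻¹' {b} =
            ⋃ c, {f : α → α | f c = b} ×ˢ {c} := by ext q; simp
        rw [this]
        refine isOpen_iUnion fun c => IsOpen.prod ?_ (isOpen_discrete _)
        exact (isOpen_discrete {b}).preimage (continuous_apply (A := fun _ : α => α) c)
      refine isClosed_iInter fun a => IsClosed.inter ?_ ?_
      · exact (isClosed_discrete {a}).preimage
          (hev.comp (continuous_fst.prodMk ((continuous_apply a).comp continuous_snd)))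
      · exact (isClosed_discrete {a}).preimage
          (hev.comp (continuous_snd.prodMk ((continuous_apply a).comp continuous_fst)))
  have hC : IsCompact ((Set.univ.pi t) ×ˢ (Set.univ.pi t)) :=
    (isCompact_univ_pi fun a => (ht a).isCompact).prod
      (isCompact_univ_pi fun a => (ht a).isCompact)
  refine (he.isCompact_preimage hC).of_isClosed_subset hS fun g hg => ?_
  exact ⟨fun a _ => (h g hg a).1, fun a _ => (h g hg a).2⟩

end PermutationTopology

section HeckePairs

variable {G : Type*} [Group G]

/-- The conjugate subgroup `x H x⁻¹`. -/
def conjSubgroup (H : Subgroup G) (x : G) : Subgroup G := H.map (MulAut.conj x).toMonoidHom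

/-- The index `L(x) = [H : H ∩ x H x⁻¹]` (equal to `0` if it is infinite). -/
noncomputable def heckeIndex (H : Subgroup G) (x : G) : ℕ := (H ⊓ conjSubgroup H x).relIndex H

/-- `(G, H)` is a Hecke pair: all the indices `[H : H ∩ x H x⁻¹]` are finite. -/
def IsHeckePair (H : Subgroup G) : Prop := ∀ x : G, heckeIndex H x ≠ 0

/-- `(G, H)` is reduced: the conjugates of `H` have trivial intersection. -/
def IsReducedPair (H : Subgroup G) : Prop := ⨅ x : G, conjSubgroup H x = ⊥

/-- The function `Δ_H(x) = L(x) / L(x⁻¹)` of a Hecke pair `(G, H)`. -/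
noncomputable def heckeModular (H : Subgroup G) (x : G) : ℝ :=
  (heckeIndex H x : ℝ) / heckeIndex H x⁻¹

/-- For a character `σ` of `H`, the set of `x ∈ G` with `σ(h) = σ(x⁻¹ h x)` for all
`h ∈ H ∩ x H x⁻¹`. -/
def specialSet (H : Subgroup G) (σ : H →* Circle) : Set G :=
  {x | ∀ (h : G) (hh : h ∈ H) (hx : x⁻¹ * h * x ∈ H), σ ⟨h, hh⟩ = σ ⟨x⁻¹ * h * x, hx⟩}

/-- The kernel of a character of `H`, as a subgroup of `G`. -/
noncomputable def charKer (H : Subgroup G) (σ : H →* Circle) : Subgroup G := σ.ker.map H.subtype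

theorem mem_conjSubgroup {H : Subgroup G} {x y : G} :
    y ∈ conjSubgroup H x ↔ x⁻¹ * y * x ∈ H := by
  simp only [conjSubgroup, Subgroup.mem_map, MulEquiv.coe_toMonoidHom, MulAut.conj_apply]
  constructor
  · rintro ⟨h, hh, rfl⟩
    simpa [mul_assoc] using hh
  · intro h
    exact ⟨_, h, by simp [mul_assoc]⟩

theorem mem_charKer {H : Subgroup G} {σ : H →* Circle} {x : G} :
    x ∈ charKer H σ ↔ ∃ h : x ∈ H, σ ⟨x, h⟩ = 1 := by
  simp [charKer, MonoidHom.mem_ker]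

theorem heckeIndex_eq (H : Subgroup G) (x : G) :
    heckeIndex H x = (conjSubgroup H x).relIndex H := by
  rw [heckeIndex, inf_comm, Subgroup.inf_relIndex_right]

theorem conjSubgroup_mul (H : Subgroup G) (x y : G) :
    conjSubgroup H (x * y) = conjSubgroup (conjSubgroup H y) x := by
  ext z
  simp [mem_conjSubgroup, mul_assoc]

theorem relIndex_conjSubgroup (H K : Subgroup G) (x : G) :
    (conjSubgroup H x).relIndex (conjSubgroup K x) = H.relIndex K :=
  Subgroup.relIndex_map_map_of_injective _ _ (MulAut.conj x).injective

theorem heckeIndex_mul_mul {K : Subgroup G} {h k : G} (hh : conjSubgroup K h = K)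
    (hk : conjSubgroup K k = K) (x : G) : heckeIndex K (h * x * k) = heckeIndex K x := by
  have := relIndex_conjSubgroup (conjSubgroup K x) K h
  rw [hh] at this
  rw [heckeIndex_eq, heckeIndex_eq, conjSubgroup_mul, hk, conjSubgroup_mul, this]

theorem conjSubgroup_charKer (H : Subgroup G) (σ : H →* Circle) {h : G} (hh : h ∈ H) :
    conjSubgroup (charKer H σ) h = charKer H σ := by
  ext y
  rw [mem_conjSubgroup, mem_charKer, mem_charKer]
  have e : ∀ hy : y ∈ H, (⟨h⁻¹ * y * h, H.mul_mem (H.mul_mem (H.inv_mem hh) hy) hh⟩ : H) =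
      ⟨h, hh⟩⁻¹ * ⟨y, hy⟩ * ⟨h, hh⟩ := fun _ => rfl
  constructor
  · rintro ⟨h1, h2⟩
    have hy : y ∈ H := by
      have := H.mul_mem (H.mul_mem hh h1) (H.inv_mem hh)
      simpa [mul_assoc] using this
    refine ⟨hy, ?_⟩
    rw [e hy, map_mul, map_mul, map_inv] at h2
    rwa [mul_right_comm, inv_mul_cancel, one_mul] at h2
  · rintro ⟨hy, h2⟩
    refine ⟨H.mul_mem (H.mul_mem (H.inv_mem hh) hy) hh, ?_⟩
    rw [e hy, map_mul, map_mul, map_inv, h2]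
    simp

/-- Orbits of `H` on `G/S` are finite when the relevant index is. -/
theorem finite_orbit {S H : Subgroup G} {x : G} (hx : (conjSubgroup S x).relIndex H ≠ 0) :
    {q : G ⧸ S | ∃ h ∈ H, q = ((h * x : G) : G ⧸ S)}.Finite := by
  have : ((conjSubgroup S x).subgroupOf H).FiniteIndex := ⟨hx⟩
  refine (Set.finite_range fun q : H ⧸ (conjSubgroup S x).subgroupOf H =>
    (((q.out : G) * x : G) : G ⧸ S)).subset ?_
  rintro _ ⟨h, hh, rfl⟩
  refine ⟨((⟨h, hh⟩ : H) : H ⧸ (conjSubgroup S x).subgroupOf H), ?_⟩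
  obtain ⟨n, hn⟩ := QuotientGroup.mk_out_eq_mul ((conjSubgroup S x).subgroupOf H) (⟨h, hh⟩ : H)
  have hn' : x⁻¹ * (n : H) * x ∈ S := mem_conjSubgroup.1 n.2
  simp only [hn]
  rw [QuotientGroup.eq]
  have := S.inv_mem hn'
  simpa [mul_assoc] using this

end HeckePairs

section CornerOfCharacter

variable {L : Type*} [TopologicalSpace L] [Group L] [IsTopologicalGroup L]
  [MeasurableSpace L] [BorelSpace L] (M : Subgroup L) (hc : IsCompact (M : Set L))
  (ho : IsOpen (M : Set L))

/-- The left Haar measure `μ` on `L` with `μ(M) = 1`, for a compact open subgroup `M`. -/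
noncomputable def normalizedHaar : Measure L :=
  Measure.haarMeasure ⟨⟨M, hc⟩, ⟨1, mem_interior.2 ⟨M, subset_rfl, ho, M.one_mem⟩⟩⟩

instance : (normalizedHaar M hc ho).IsHaarMeasure := by
  unfold normalizedHaar; infer_instance

theorem normalizedHaar_self : normalizedHaar M hc ho M = 1 := Measure.haarMeasure_self

variable (ρ : M →* Circle) (hρ : Continuous ρ)

open Classical in
/-- The extension of a character of `M` by zero to a function on `L`. -/
noncomputable def extendByZero (x : L) : ℂ := if h : x ∈ M then (ρ ⟨x, h⟩ : ℂ) else 0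

theorem extendByZero_of_mem {x : L} (h : x ∈ M) : extendByZero M ρ x = (ρ ⟨x, h⟩ : ℂ) := dif_pos h

theorem extendByZero_of_notMem {x : L} (h : x ∉ M) : extendByZero M ρ x = 0 := dif_neg h

theorem continuous_extendByZero (ho : IsOpen (M : Set L)) (hρ : Continuous ρ) :
    Continuous (extendByZero M ρ) := by
  have hcl : IsClosed (M : Set L) := M.isClosed_of_isOpen ho
  rw [continuous_iff_continuousAt]
  intro x
  by_cases hx : x ∈ M
  · refine ContinuousOn.continuousAt (s := (M : Set L)) ?_ (ho.mem_nhds hx)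
    rw [continuousOn_iff_continuous_domRestrict]
    have : (M : Set L).domRestrict (extendByZero M ρ) = fun y : M => (ρ y : ℂ) := by
      funext y
      exact extendByZero_of_mem M ρ y.2
    rw [this]
    exact continuous_induced_dom.comp hρ
  · refine ContinuousOn.continuousAt (s := (M : Set L)ᶜ) ?_ (hcl.isOpen_compl.mem_nhds hx)
    exact (continuousOn_const (c := (0 : ℂ))).congr fun y hy => extendByZero_of_notMem M ρ hy

/-- The function `p = χ_M ρ` in `C_c(L)`. -/
noncomputable def charProj : ConvAlg (normalizedHaar M hc ho) :=
  CompactlySupportedContinuousMap.mk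
    ⟨extendByZero M ρ, continuous_extendByZero M ρ ho hρ⟩
    (HasCompactSupport.intro' hc (M.isClosed_of_isOpen ho) fun _ hx =>
      extendByZero_of_notMem M ρ hx)

theorem charProj_apply (x : L) : charProj M hc ho ρ hρ x = extendByZero M ρ x := rfl

theorem modularFun_eq_one_of_mem [LocallyCompactSpace L] (hc : IsCompact (M : Set L))
    (ho : IsOpen (M : Set L)) {x : L} (hx : x ∈ M) : modularFun x = 1 := by
  let μ := normalizedHaar M hc ho
  have hcl : IsClosed (M : Set L) := M.isClosed_of_isOpen ho
  have h := Measure.measure_isMulInvariant_eq_smul_of_isCompact_closure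
    (Measure.map (· * x⁻¹) μ) μ (s := (M : Set L)) (by rwa [hcl.closure_eq])
  rw [Measure.map_apply (measurable_mul_const x⁻¹) ho.measurableSet] at h
  have hpre : (fun y => y * x⁻¹) ⁻¹' (M : Set L) = M := by
    ext y
    exact M.mul_mem_cancel_right (M.inv_mem hx)
  rw [hpre, normalizedHaar_self, ENNReal.smul_def, smul_eq_mul, mul_one] at h
  have h' : Measure.haarScalarFactor (Measure.map (· * x⁻¹) μ) μ = 1 := by
    exact_mod_cast h.symm
  change ((Measure.modularCharacterFun x⁻¹ : ℝ≥0) : ℝ) = 1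
  rw [Measure.modularCharacterFun_eq_haarScalarFactor μ, h']
  simp

theorem isStarProjection_charProj [LocallyCompactSpace L] :
    IsStarProjection (charProj M hc ho ρ hρ) where
  isIdempotentElem := by
    refine ConvAlg.ext fun x => ?_
    rw [ConvAlg.mul_apply]
    simp only [charProj_apply]
    have : ∀ y, extendByZero M ρ y * extendByZero M ρ (y⁻¹ * x) =
        (M : Set L).indicator (fun _ => extendByZero M ρ x) y := by
      intro y
      by_cases hy : y ∈ M
      · rw [Set.indicator_of_mem (show y ∈ (M : Set L) from hy)]
        by_cases hx : x ∈ M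
        · rw [extendByZero_of_mem M ρ hy, extendByZero_of_mem M ρ hx,
            extendByZero_of_mem M ρ (M.mul_mem (M.inv_mem hy) hx), ← Circle.coe_mul, ← map_mul]
          congr 3
          exact Subtype.ext (mul_inv_cancel_left y x)
        · rw [extendByZero_of_notMem M ρ hx, extendByZero_of_notMem M ρ (x := y⁻¹ * x), mul_zero]
          exact fun h => hx (by simpa using M.mul_mem hy h)
      · rw [Set.indicator_of_notMem (show y ∉ (M : Set L) from hy),
          extendByZero_of_notMem M ρ hy, zero_mul]
    simp only [this]
    rw [integral_indicator_const _ ho.measurableSet, Measure.real, normalizedHaar_self]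
    simp
  isSelfAdjoint := by
    refine ConvAlg.ext fun x => ?_
    rw [ConvAlg.star_apply]
    simp only [charProj_apply]
    by_cases hx : x ∈ M
    · rw [modularFun_eq_one_of_mem M hc ho (M.inv_mem hx), extendByZero_of_mem M ρ hx,
        extendByZero_of_mem M ρ (M.inv_mem hx)]
      have : (⟨x⁻¹, M.inv_mem hx⟩ : M) = ⟨x, hx⟩⁻¹ := rfl
      rw [this, map_inv, Circle.coe_inv_eq_conj]
      simp
    · rw [extendByZero_of_notMem M ρ hx, extendByZero_of_notMem M ρ]
      · simp
      · simpa using hx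

end CornerOfCharacter

/-- A (`1`-dimensional) Hecke triple `(G, H, σ)`: a Hecke pair `(G, H)` and a one-dimensional
unitary representation `σ` of `H` with finite range. -/
structure HeckeTriple (G : Type*) [Group G] where
  /-- the subgroup `H` -/
  H : Subgroup G
  /-- `(G, H)` is a Hecke pair -/
  isHeckePair : IsHeckePair H
  /-- the character `σ` -/
  σ : H →* Circle
  /-- `σ(H)` is finite -/
  finite_range : (Set.range σ).Finite

namespace HeckeTriple

variable {G : Type*} [Group G] (T : HeckeTriple G)

/-- The kernel `K` of `σ`. -/
noncomputable def K : Subgroup G := charKer T.H T.σ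

/-- The Hecke triple is reduced if the Hecke pair `(G, K)` is. -/
def IsReduced : Prop := IsReducedPair T.K

/-! ### The generalised Hecke algebra -/

/-- The vector space of functions `f : G → ℂ` with finite support in `H \ G / H` such that
`f (h x k) = σ(h) f(x) σ(k)`. -/
noncomputable def heckeAlgebra : Submodule ℂ (G → ℂ) where
  carrier := {f | (DoubleCoset.mk T.H T.H '' Function.support f).Finite ∧
    ∀ (h k : T.H) (x : G), f (h * x * k) = (T.σ h : ℂ) * f x * (T.σ k : ℂ)}
  add_mem' := by
    rintro f g ⟨hf, hf'⟩ ⟨hg, hg'⟩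
    refine ⟨(hf.union hg).subset ?_, fun h k x => ?_⟩
    · rw [← Set.image_union]
      exact Set.image_mono (Function.support_add f g)
    · simp only [Pi.add_apply, hf', hg']
      ring
  zero_mem' := by
    refine ⟨?_, fun h k x => by simp⟩
    simp
  smul_mem' := by
    rintro c f ⟨hf, hf'⟩
    refine ⟨hf.subset (Set.image_mono (Function.support_const_smul_subset c f)), fun h k x => ?_⟩
    simp only [Pi.smul_apply, hf', smul_eq_mul]
    ring

/-- The convolution `(f * g)(x) = ∑_{yH ∈ G/H} f(y) g(y⁻¹ x)`, the sum being over a set of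
representatives `y` of the left cosets. -/
noncomputable def heckeConv (f g : G → ℂ) (x : G) : ℂ :=
  ∑ᶠ q : G ⧸ T.H, f q.out * g (q.out⁻¹ * x)

/-- The involution `f^*(x) = Δ_K(x⁻¹) * conj (f (x⁻¹))`. -/
noncomputable def heckeStar (f : G → ℂ) (x : G) : ℂ :=
  (heckeModular T.K x⁻¹ : ℂ) * star (f x⁻¹)

variable {T} in
theorem finite_image_mk {f : G → ℂ} (hf : f ∈ T.heckeAlgebra) :
    ((fun x : G => (x : G ⧸ T.H)) '' Function.support f).Finite := by
  have h1 : ∀ d : DoubleCoset.Quotient (T.H : Set G) T.H,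
      {q : G ⧸ T.H | ∃ h ∈ T.H, q = ((h * d.out : G) : G ⧸ T.H)}.Finite := by
    intro d
    refine finite_orbit ?_
    rw [← heckeIndex_eq]
    exact T.isHeckePair _
  refine (hf.1.biUnion fun d _ => h1 d).subset ?_
  rintro _ ⟨x, hx, rfl⟩
  refine Set.mem_biUnion (Set.mem_image_of_mem _ hx) ?_
  obtain ⟨h, k, hh, hk, he⟩ := DoubleCoset.mk_out_eq_mul T.H T.H x
  refine ⟨h⁻¹, T.H.inv_mem hh, ?_⟩
  rw [QuotientGroup.eq, he]
  simpa [mul_assoc] using hk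

theorem heckeConv_mem {f g : G → ℂ} (hf : f ∈ T.heckeAlgebra) (hg : g ∈ T.heckeAlgebra) :
    T.heckeConv f g ∈ T.heckeAlgebra := by
  refine ⟨?_, ?_⟩
  · let π : G ⧸ T.H → DoubleCoset.Quotient (T.H : Set G) T.H := fun q => DoubleCoset.mk _ _ q.out
    have hπ : ∀ x : G, DoubleCoset.mk T.H T.H x = π (x : G ⧸ T.H) := by
      intro x
      obtain ⟨n, hn⟩ := QuotientGroup.mk_out_eq_mul T.H x
      simp only [π, hn]
      exact (DoubleCoset.eq _ _ _ _).2 ⟨1, T.H.one_mem, n, n.2, by simp⟩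
    have hfin := ((finite_image_mk hf).biUnion (t := fun q =>
      (fun r : G ⧸ T.H => q.out • r) '' ((fun x : G => (x : G ⧸ T.H)) '' Function.support g))
      fun q _ => (finite_image_mk hg).image _).image π
    refine hfin.subset ?_
    rintro _ ⟨x, hx, rfl⟩
    obtain ⟨q, hq⟩ : ∃ q : G ⧸ T.H, f q.out * g (q.out⁻¹ * x) ≠ 0 := by
      by_contra! hcon
      exact hx (by simp [heckeConv, hcon])
    refine ⟨(x : G ⧸ T.H), ?_, (hπ x).symm⟩
    refine Set.mem_biUnion (x := q) ⟨q.out, left_ne_zero_of_mul hq, q.out_eq'⟩ ?_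
    refine ⟨_, ⟨_, right_ne_zero_of_mul hq, rfl⟩, ?_⟩
    simp
  · intro h k x
    have hout : ∀ (x y y' : G), (y : G ⧸ T.H) = y' →
        f y * g (y⁻¹ * x) = f y' * g (y'⁻¹ * x) := by
      intro x y y' hy
      obtain ⟨n, hn, rfl⟩ : ∃ n ∈ T.H, y' = y * n :=
        ⟨y⁻¹ * y', QuotientGroup.eq.1 hy, by simp⟩
      have e1 := hf.2 1 ⟨n, hn⟩ y
      have e2 := hg.2 (⟨n, hn⟩⁻¹) 1 (y⁻¹ * x)
      simp only [OneMemClass.coe_one, one_mul, mul_one, map_one, Circle.coe_one, map_inv,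
        InvMemClass.coe_inv] at e1 e2
      rw [e1, mul_inv_rev, mul_assoc n⁻¹, e2, Circle.coe_inv]
      field_simp [Circle.coe_ne_zero]
    unfold heckeConv
    rw [← finsum_comp_equiv (MulAction.toPerm (h : G) : Equiv.Perm (G ⧸ T.H)),
      mul_right_comm, ← smul_eq_mul ((T.σ h : ℂ) * (T.σ k : ℂ)), smul_finsum]
    refine finsum_congr fun q => ?_
    rw [hout _ _ ((h : G) * q.out) (by
      rw [QuotientGroup.out_eq']
      exact congrArg (fun r => (h : G) • r) (QuotientGroup.out_eq' q).symm)]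
    have e1 := hf.2 h 1 q.out
    have e2 := hg.2 1 k (q.out⁻¹ * x)
    simp only [OneMemClass.coe_one, one_mul, mul_one, map_one, Circle.coe_one] at e1 e2
    rw [e1, show ((h : G) * q.out)⁻¹ * (h * x * k) = q.out⁻¹ * x * k by group, e2, smul_eq_mul]
    ring

theorem heckeStar_mem {f : G → ℂ} (hf : f ∈ T.heckeAlgebra) :
    T.heckeStar f ∈ T.heckeAlgebra := by
  refine ⟨?_, ?_⟩
  · refine (hf.1.image fun d => DoubleCoset.mk T.H T.H d.out⁻¹).subset ?_
    rintro _ ⟨x, hx, rfl⟩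
    have hx' : f x⁻¹ ≠ 0 := fun h0 => hx (by simp [heckeStar, h0])
    refine ⟨_, ⟨x⁻¹, hx', rfl⟩, ?_⟩
    obtain ⟨h, k, hh, hk, he⟩ := DoubleCoset.mk_out_eq_mul T.H T.H x⁻¹
    refine (DoubleCoset.eq _ _ _ _).2 ⟨k, hk, h, hh, ?_⟩
    rw [he]
    group
  · intro h k x
    have hinv : ((h : G) * x * k)⁻¹ = (k⁻¹ : T.H) * x⁻¹ * (h⁻¹ : T.H) := by
      simp [mul_assoc]
    have hm : heckeModular T.K ((h : G) * x * k)⁻¹ = heckeModular T.K x⁻¹ := by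
      unfold heckeModular K
      rw [inv_inv, inv_inv, hinv,
        heckeIndex_mul_mul (conjSubgroup_charKer _ _ (k⁻¹).2) (conjSubgroup_charKer _ _ (h⁻¹).2),
        heckeIndex_mul_mul (conjSubgroup_charKer _ _ h.2) (conjSubgroup_charKer _ _ k.2)]
    simp only [heckeStar]
    rw [hm, hinv, hf.2, map_inv, map_inv, Circle.coe_inv_eq_conj, Circle.coe_inv_eq_conj]
    simp only [star_mul', RCLike.star_def, Complex.conj_conj]
    ring

noncomputable instance : Mul T.heckeAlgebra where
  mul f g := ⟨T.heckeConv f g, T.heckeConv_mem f.2 g.2⟩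

noncomputable instance : Star T.heckeAlgebra where
  star f := ⟨T.heckeStar f, T.heckeStar_mem f.2⟩

/-! ### The Schlichting completion -/

/-- The action of `G` on `G/K` by left translation. -/
noncomputable def perm : G →* Equiv.Perm (G ⧸ T.K) := MulAction.toPermHom G (G ⧸ T.K)

/-- The group `G_σ` of the Schlichting completion of `(G, K)`: the closure of (the image of) `G`
in the group of permutations of `G/K` with the topology of pointwise convergence. The topology
that this induces on `G` is the Hecke topology from `(G, K)`, as the stabiliser of the point `xK`
is `x K x⁻¹`. -/
abbrev Gσ : Type _ := ↥(T.perm.range.topologicalClosure)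

/-- The canonical homomorphism of `G` onto a dense subgroup of `G_σ`. -/
noncomputable def ι : G →* T.Gσ :=
  T.perm.codRestrict _ fun x => T.perm.range.le_topologicalClosure ⟨x, rfl⟩

/-- The closure `H_σ` of `H` in `G_σ`. -/
noncomputable def Hσ : Subgroup T.Gσ := (T.H.map T.ι).topologicalClosure

theorem ι_apply (x y : G) : (T.ι x : Equiv.Perm (G ⧸ T.K)) (y : G ⧸ T.K) = ((x * y : G) : G ⧸ T.K) :=
  rfl

theorem denseRange_ι : DenseRange T.ι := by
  intro g
  rw [closure_subtype, ← Set.range_comp]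
  exact g.2

theorem isOpen_eval (q r : G ⧸ T.K) :
    IsOpen {g : T.Gσ | (g : Equiv.Perm (G ⧸ T.K)) q = r} :=
  (isOpen_perm_eval q r).preimage continuous_subtype_val

theorem K_le : T.K ≤ T.H := fun _ hx => (mem_charKer.1 hx).1

/-- `H_σ` consists of the elements that move the base point of `G/K` within `H/K`. -/
theorem mem_Hσ {g : T.Gσ} :
    g ∈ T.Hσ ↔ ∃ h : T.H, (g : Equiv.Perm (G ⧸ T.K)) ((1 : G) : G ⧸ T.K) = ((h : G) : G ⧸ T.K) := by
  constructor
  · intro hg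
    obtain ⟨_, hs, ⟨h, hh, rfl⟩⟩ := mem_closure_iff.1 hg _
      (T.isOpen_eval ((1 : G) : G ⧸ T.K) _) rfl
    refine ⟨⟨h, hh⟩, ?_⟩
    rw [← hs, ι_apply, mul_one]
  · rintro ⟨h, hh⟩
    refine mem_closure_iff.2 fun U hU hgU => ?_
    obtain ⟨_, ⟨hxU, hx⟩, x, rfl⟩ := mem_closure_iff.1 (T.denseRange_ι g)
      _ (hU.inter (T.isOpen_eval ((1 : G) : G ⧸ T.K) _)) ⟨hgU, hh⟩
    refine ⟨T.ι x, hxU, x, ?_, rfl⟩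
    change _ = _ at hx
    rw [ι_apply, mul_one, eq_comm, QuotientGroup.eq] at hx
    simpa using T.H.mul_mem h.2 (T.K_le hx)

theorem ι_mem_Hσ {h : G} (hh : h ∈ T.H) : T.ι h ∈ T.Hσ :=
  (T.H.map T.ι).le_topologicalClosure ⟨h, hh, rfl⟩

theorem isOpen_Hσ : IsOpen (T.Hσ : Set T.Gσ) := by
  have : (T.Hσ : Set T.Gσ) = ⋃ h : T.H,
      {g : T.Gσ | (g : Equiv.Perm (G ⧸ T.K)) ((1 : G) : G ⧸ T.K) = ((h : G) : G ⧸ T.K)} := by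
    ext g
    simp [mem_Hσ]
  rw [this]
  exact isOpen_iUnion fun h => T.isOpen_eval _ _

theorem relIndex_K : T.K.relIndex T.H ≠ 0 := by
  have := T.finite_range
  have h : Finite T.σ.range := this
  rw [K, charKer, Subgroup.relIndex, Subgroup.subgroupOf,
    Subgroup.comap_map_eq_self_of_injective T.H.subtype_injective, Subgroup.index_ker]
  exact Nat.card_pos.ne'

theorem isCompact_Hσ : IsCompact (T.Hσ : Set T.Gσ) := by
  have hcl : IsClosed (T.Hσ : Set T.Gσ) := Subgroup.isClosed_topologicalClosure _
  have hemb : IsClosedEmbedding (Subtype.val : T.Gσ → Equiv.Perm (G ⧸ T.K)) :=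
    (Subgroup.isClosed_topologicalClosure _).isClosedEmbedding_subtypeVal
  rw [hemb.isCompact_iff]
  have hval : ∀ g ∈ T.Hσ, ∀ x : G, ∃ h ∈ T.H,
      (g : Equiv.Perm (G ⧸ T.K)) (x : G ⧸ T.K) = ((h * x : G) : G ⧸ T.K) := by
    intro g hg x
    obtain ⟨_, hs, ⟨h, hh, rfl⟩⟩ := mem_closure_iff.1 hg _
      (T.isOpen_eval (x : G ⧸ T.K) _) rfl
    exact ⟨h, hh, hs.symm⟩
  refine isCompact_of_finite_orbits (hemb.isClosedMap _ hcl)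
    (fun q => {r | ∃ h ∈ T.H, r = ((h * q.out : G) : G ⧸ T.K)}) (fun q => finite_orbit ?_) ?_
  · refine Subgroup.relIndex_ne_zero_trans (K := conjSubgroup T.H q.out) ?_ ?_
    · rw [relIndex_conjSubgroup]
      exact T.relIndex_K
    · rw [← heckeIndex_eq]
      exact T.isHeckePair _
  · rintro _ ⟨g, hg, rfl⟩ q
    have h1 := hval g hg q.out
    have h2 := hval g⁻¹ (T.Hσ.inv_mem hg) q.out
    rw [QuotientGroup.out_eq'] at h1 h2
    exact ⟨h1, h2⟩

instance : LocallyCompactSpace T.Gσ :=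
  T.isCompact_Hσ.locallyCompactSpace_of_mem_nhds_of_group (T.isOpen_Hσ.mem_nhds T.Hσ.one_mem)

theorem σ_eq_of_mk_eq {h h' : T.H} (e : ((h : G) : G ⧸ T.K) = ((h' : G) : G ⧸ T.K)) :
    T.σ h = T.σ h' := by
  rw [QuotientGroup.eq, K, mem_charKer] at e
  obtain ⟨_, e⟩ := e
  have e' : T.σ (h⁻¹ * h') = 1 := e
  rwa [map_mul, map_inv, inv_mul_eq_one] at e'

/-- The extension of `σ` to `H_σ`: if `g ∈ H_σ` moves the base point of `G/K` to `hK`, `h ∈ H`,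
then `g` goes to `σ(h)`. -/
noncomputable def σbarFun (g : T.Hσ) : Circle := T.σ (T.mem_Hσ.1 g.2).choose

theorem σbarFun_eq {g : T.Hσ} {h : T.H}
    (e : ((g : T.Gσ) : Equiv.Perm (G ⧸ T.K)) ((1 : G) : G ⧸ T.K) = ((h : G) : G ⧸ T.K)) :
    T.σbarFun g = T.σ h :=
  T.σ_eq_of_mk_eq ((T.mem_Hσ.1 g.2).choose_spec.symm.trans e)

theorem σbarFun_ι (h : T.H) : T.σbarFun ⟨T.ι h, T.ι_mem_Hσ h.2⟩ = T.σ h :=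
  T.σbarFun_eq (by rw [ι_apply, mul_one])

theorem continuous_σbarFun : Continuous T.σbarFun := by
  refine IsLocallyConstant.continuous ((IsLocallyConstant.iff_exists_open _).2 fun g => ?_)
  obtain ⟨h, hh⟩ := T.mem_Hσ.1 g.2
  refine ⟨_, (T.isOpen_eval ((1 : G) : G ⧸ T.K) ((h : G) : G ⧸ T.K)).preimage
    continuous_subtype_val, hh, fun g' hg' => ?_⟩
  rw [T.σbarFun_eq hh, T.σbarFun_eq hg']

theorem isDense_ι_H (g : T.Hσ) :
    g ∈ closure (Set.range fun h : T.H => (⟨T.ι h, T.ι_mem_Hσ h.2⟩ : T.Hσ)) := by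
  rw [closure_subtype, ← Set.range_comp]
  have hg : (g : T.Gσ) ∈ closure ((T.H.map T.ι : Subgroup T.Gσ) : Set T.Gσ) := g.2
  convert hg using 2
  ext y
  simp

/-- The extension of `σ` to a continuous character of `H_σ`. It is the only one, as the image of
`H` is dense in `H_σ`. -/
noncomputable def σbar : T.Hσ →* Circle where
  toFun := T.σbarFun
  map_one' := by
    rw [← map_one T.σ, ← T.σbarFun_ι 1]
    congr 1
    exact Subtype.ext (map_one T.ι).symm
  map_mul' a b := by
    have hd : DenseRange fun h : T.H => (⟨T.ι h, T.ι_mem_Hσ h.2⟩ : T.Hσ) := T.isDense_ι_H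
    refine congrFun (DenseRange.equalizer
      (g := fun p : T.Hσ × T.Hσ => T.σbarFun (p.1 * p.2))
      (h := fun p : T.Hσ × T.Hσ => T.σbarFun p.1 * T.σbarFun p.2) (hd.prodMap hd)
      (T.continuous_σbarFun.comp continuous_mul)
      ((T.continuous_σbarFun.comp continuous_fst).mul (T.continuous_σbarFun.comp continuous_snd))
      ?_) (a, b)
    funext p
    simp only [Function.comp_apply, Prod.map_fst, Prod.map_snd, σbarFun_ι]
    rw [← map_mul, ← T.σbarFun_ι]
    congr 1
    exact Subtype.ext (map_mul T.ι _ _).symm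

theorem continuous_σbar : Continuous T.σbar := T.continuous_σbarFun

theorem σbar_ι (h : T.H) : T.σbar ⟨T.ι h, T.ι_mem_Hσ h.2⟩ = T.σ h := T.σbarFun_ι h

/-! ### The corner of `C_c(B_σ)` -/

variable (B : Subgroup G)

/-- The closure `B_σ` in `G_σ` of a subgroup `B` of `G`. -/
noncomputable def Bσ : Subgroup T.Gσ := (B.map T.ι).topologicalClosure

theorem isClosedEmbedding_Bσ : IsClosedEmbedding (Subtype.val : T.Bσ B → T.Gσ) :=
  (Subgroup.isClosed_topologicalClosure _).isClosedEmbedding_subtypeVal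

instance : LocallyCompactSpace (T.Bσ B) := (T.isClosedEmbedding_Bσ B).locallyCompactSpace

/-- `H_σ ∩ B_σ` as a subgroup of `B_σ`; this is `H_σ` when `H ≤ B`. -/
noncomputable def HσB : Subgroup (T.Bσ B) := T.Hσ.subgroupOf (T.Bσ B)

theorem isCompact_HσB : IsCompact (T.HσB B : Set (T.Bσ B)) :=
  (T.isClosedEmbedding_Bσ B).isCompact_preimage T.isCompact_Hσ

theorem isOpen_HσB : IsOpen (T.HσB B : Set (T.Bσ B)) :=
  T.isOpen_Hσ.preimage continuous_subtype_val

/-- The extended character `σ` of `H_σ`, regarded as a subgroup of `B_σ`. -/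
noncomputable def σB : T.HσB B →* Circle :=
  T.σbar.comp ((T.Bσ B).subtype.subgroupComap T.Hσ)

theorem continuous_σB : Continuous (T.σB B) :=
  T.continuous_σbar.comp
    (Continuous.subtype_mk (continuous_subtype_val.comp continuous_subtype_val) _)

/-- The left Haar measure on `B_σ`, normalised so that `H_σ` has measure `1`. -/
noncomputable def μB : Measure (T.Bσ B) :=
  normalizedHaar (T.HσB B) (T.isCompact_HσB B) (T.isOpen_HσB B)

instance : (T.μB B).IsHaarMeasure := by unfold μB; infer_instance

/-- The projection `p_σ = χ_{H_σ} σ` in `C_c(B_σ)`. -/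
noncomputable def pσ : ConvAlg (T.μB B) :=
  charProj (T.HσB B) (T.isCompact_HσB B) (T.isOpen_HσB B) (T.σB B) (T.continuous_σB B)

theorem isStarProjection_pσ : IsStarProjection (T.pσ B) := isStarProjection_charProj _ _ _ _ _

/-- The corner `p_σ C_c(B_σ) p_σ`. -/
noncomputable def corner : NonUnitalStarSubalgebra ℂ (ConvAlg (T.μB B)) :=
  starCorner (T.pσ B) (T.isStarProjection_pσ B)

end HeckeTriple

/-! Everything is read off from the action on `G/K`. If `g` in `G_σ` sends the base point to `xK`
with `x` in `G`, then `g = ι x * k`, where `k` fixes the base point and hence lies in `H_σ`. The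
sets `H_σ`, `B_σ` and the special set of `(H_σ, σbar)` are all stable under right multiplication by
such `k`, so membership of `g` is decided by `x` (`mem_Hσ_iff`, `mem_Bσ_iff`, `mem_specialSet_iff`).
This gives the description of `B_σ`. Where a product or a conjugate is involved, an element of `G_σ`
is replaced by one of `G` that agrees with it at two points of `G/K` (`exists_ι_eq`); density
provides it.

For the algebras, an element `f` of the Hecke algebra vanishes off `B` (`apply_eq_zero_of_notMem`)
and is right `K`-invariant, so it is a function on `G/K`. Composing it with `b ↦ b · K` gives a
locally constant function `extend f` on `B_σ`, supported on finitely many cosets of the compact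
group `H_σ`. The corner consists of the functions that transform by `σ` under `H_σ` on both sides
(`mem_starCorner_charProj`), so it contains `extend f`; restriction to `B`, extended by zero to `G`,
is the inverse map.

Products match because the convolution integrand is constant on left cosets of `H_σ`, which have
measure 1 (`integral_comp_cosetMap`). Involutions match because the modular function at `x` is `L(x)
/ L(x⁻¹)` for any compact open subgroup (`modularFun_eq_heckeModular`); for the closure of `K` these
indices are, by density, those of `K` in `G` (`heckeIndex_KσB`). -/

namespace HeckeTriple

/-! ### Approximating `G_σ` by `G` at points of `G/K` -/

variable {G : Type*} [Group G] (T : HeckeTriple G)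

/-- The base point of `G/K`. -/
noncomputable abbrev basePt : G ⧸ T.K := ((1 : G) : G ⧸ T.K)

theorem ι_smul (x : G) (q : G ⧸ T.K) : (T.ι x : Equiv.Perm (G ⧸ T.K)) q = x • q := rfl

theorem ι_basePt (x : G) :
    (T.ι x : Equiv.Perm (G ⧸ T.K)) T.basePt = ((x : G) : G ⧸ T.K) := by
  rw [ι_apply, mul_one]

theorem coe_mul_apply (g g' : T.Gσ) (q : G ⧸ T.K) :
    ((g * g' : T.Gσ) : Equiv.Perm (G ⧸ T.K)) q =
      (g : Equiv.Perm (G ⧸ T.K)) ((g' : Equiv.Perm (G ⧸ T.K)) q) := rfl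

/-- Elements of `G` approximate those of `G_σ` at two points of `G/K`. -/
theorem exists_ι_eq (g : T.Gσ) (p q : G ⧸ T.K) :
    ∃ x : G, (g : Equiv.Perm (G ⧸ T.K)) p = x • p ∧ (g : Equiv.Perm (G ⧸ T.K)) q = x • q := by
  obtain ⟨_, ⟨h1, h2⟩, x, rfl⟩ := mem_closure_iff.1 (T.denseRange_ι g) _
    ((T.isOpen_eval p _).inter (T.isOpen_eval q _)) ⟨rfl, rfl⟩
  exact ⟨x, h1.symm, h2.symm⟩

theorem exists_basePt_eq (g : T.Gσ) :
    ∃ x : G, (g : Equiv.Perm (G ⧸ T.K)) T.basePt = ((x : G) : G ⧸ T.K) :=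
  ⟨_, (QuotientGroup.out_eq' _).symm⟩

theorem σbar_eq {g : T.Gσ} (hg : g ∈ T.Hσ) {h : T.H}
    (e : (g : Equiv.Perm (G ⧸ T.K)) T.basePt = ((h : G) : G ⧸ T.K)) :
    T.σbar ⟨g, hg⟩ = T.σ h :=
  T.σbarFun_eq e

theorem mem_H_of_mem_Hσ {g : T.Gσ} (hg : g ∈ T.Hσ) {x : G}
    (e : (g : Equiv.Perm (G ⧸ T.K)) T.basePt = ((x : G) : G ⧸ T.K)) : x ∈ T.H := by
  obtain ⟨h, hh⟩ := T.mem_Hσ.1 hg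
  rw [hh, QuotientGroup.eq] at e
  simpa using T.H.mul_mem h.2 (T.K_le e)

/-- Source of the factorisation `g = ι x * k` with `k` in the stabiliser of the base point. -/
theorem fixes_basePt {g : T.Gσ} {x : G}
    (e : (g : Equiv.Perm (G ⧸ T.K)) T.basePt = ((x : G) : G ⧸ T.K)) :
    (((T.ι x)⁻¹ * g : T.Gσ) : Equiv.Perm (G ⧸ T.K)) T.basePt = T.basePt := by
  rw [coe_mul_apply, e, ← map_inv, ι_apply, inv_mul_cancel]

theorem mem_Hσ_of_fixes {g : T.Gσ} (e : (g : Equiv.Perm (G ⧸ T.K)) T.basePt = T.basePt) :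
    g ∈ T.Hσ := T.mem_Hσ.2 ⟨1, e⟩

/-! ### The special sets -/

/-- Conjugation by `k` preserves `M`, and it preserves `ρ` because the circle is commutative. The
ambient group is arbitrary because both `(G, H)` and `(G_σ, H_σ)` are needed. -/
theorem mem_specialSet_mul_right {L : Type*} [Group L] {M : Subgroup L} {ρ : M →* Circle}
    {x k : L} (hx : x ∈ specialSet M ρ) (hk : k ∈ M) : x * k ∈ specialSet M ρ := by
  intro h hh hxk
  have e : x⁻¹ * h * x = k * ((x * k)⁻¹ * h * (x * k)) * k⁻¹ := by group
  have h1 : x⁻¹ * h * x ∈ M := by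
    rw [e]; exact M.mul_mem (M.mul_mem hk hxk) (M.inv_mem hk)
  rw [hx h hh h1]
  have e2 : (⟨x⁻¹ * h * x, h1⟩ : M) = ⟨k, hk⟩ * ⟨(x * k)⁻¹ * h * (x * k), hxk⟩ * ⟨k, hk⟩⁻¹ :=
    Subtype.ext e
  rw [e2, map_mul, map_mul, map_inv, mul_right_comm, mul_inv_cancel, one_mul]

/-- Source of the inclusion `T.H ≤ B`, called `hHB` in the later lemmas. -/
theorem subset_specialSet {L : Type*} [Group L] {M : Subgroup L} {ρ : M →* Circle} :
    (M : Set L) ⊆ specialSet M ρ := by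
  intro x hx
  rw [← one_mul x]
  exact mem_specialSet_mul_right (by intro h hh hx; congr 1; ext; simp) hx

theorem ι_mem_specialSet {x : G} : T.ι x ∈ specialSet T.Hσ T.σbar ↔ x ∈ specialSet T.H T.σ := by
  constructor
  · intro hx h hh hxh
    have e : (T.ι x)⁻¹ * T.ι h * T.ι x = T.ι (x⁻¹ * h * x) := by simp
    have := hx (T.ι h) (T.ι_mem_Hσ hh) (e ▸ T.ι_mem_Hσ hxh)
    rwa [T.σbar_eq (h := ⟨h, hh⟩) _ (T.ι_basePt h),
      T.σbar_eq (h := ⟨_, hxh⟩) _ (by rw [e]; exact T.ι_basePt _)] at this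
  · intro hx h hh hxh
    -- The base point determines `σbar h`, and the point `xK` determines `σbar (x⁻¹ h x)`, since
    -- `x⁻¹ h x` sends the base point to `x⁻¹ · h(xK)`. One `y` in `G` serves for both.
    obtain ⟨y, h1, h2⟩ := T.exists_ι_eq h T.basePt ((x : G) : G ⧸ T.K)
    have h1' : (h : Equiv.Perm (G ⧸ T.K)) T.basePt = ((y : G) : G ⧸ T.K) := by
      rw [h1]; exact T.ι_basePt y
    have h3 : (((T.ι x)⁻¹ * h * T.ι x : T.Gσ) : Equiv.Perm (G ⧸ T.K)) T.basePt =
        ((x⁻¹ * y * x : G) : G ⧸ T.K) := by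
      rw [coe_mul_apply, coe_mul_apply, ι_basePt, h2, ← map_inv, ι_smul, ← mul_smul]
      rfl
    have hy := T.mem_H_of_mem_Hσ hh h1'
    have hy' := T.mem_H_of_mem_Hσ hxh h3
    rw [T.σbar_eq (h := ⟨y, hy⟩) hh h1', T.σbar_eq (h := ⟨_, hy'⟩) hxh h3]
    exact hx y hy hy'

theorem mem_specialSet_iff {g : T.Gσ} {x : G}
    (e : (g : Equiv.Perm (G ⧸ T.K)) T.basePt = ((x : G) : G ⧸ T.K)) :
    g ∈ specialSet T.Hσ T.σbar ↔ x ∈ specialSet T.H T.σ := by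
  rw [← ι_mem_specialSet]
  have hk := T.mem_Hσ_of_fixes (T.fixes_basePt e)
  constructor
  · intro hg
    simpa using mem_specialSet_mul_right hg (T.Hσ.inv_mem hk)
  · intro hg
    simpa using mem_specialSet_mul_right hg hk

variable {B : Subgroup G}

theorem ι_mem_Bσ {x : G} (hx : x ∈ B) : T.ι x ∈ T.Bσ B :=
  (B.map T.ι).le_topologicalClosure ⟨x, hx, rfl⟩

/-- The elements sending the base point to `xK` form an open set, so some `b` in `B` has `bK = xK`;
and `K ≤ H ≤ B`. -/
theorem mem_of_mem_Bσ (hHB : T.H ≤ B) {g : T.Gσ} (hg : g ∈ T.Bσ B) {x : G}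
    (e : (g : Equiv.Perm (G ⧸ T.K)) T.basePt = ((x : G) : G ⧸ T.K)) : x ∈ B := by
  obtain ⟨_, hs, ⟨b, hb, rfl⟩⟩ := mem_closure_iff.1 hg _ (T.isOpen_eval T.basePt _) e
  change _ = _ at hs
  rw [ι_basePt, QuotientGroup.eq] at hs
  simpa using B.mul_mem hb (hHB (T.K_le hs))

theorem Hσ_le_Bσ (hHB : T.H ≤ B) : T.Hσ ≤ T.Bσ B :=
  Subgroup.topologicalClosure_mono (Subgroup.map_mono hHB)

theorem mem_Bσ_iff (hHB : T.H ≤ B) {g : T.Gσ} {x : G}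
    (e : (g : Equiv.Perm (G ⧸ T.K)) T.basePt = ((x : G) : G ⧸ T.K)) :
    g ∈ T.Bσ B ↔ x ∈ B := by
  refine ⟨fun hg => T.mem_of_mem_Bσ hHB hg e, fun hx => ?_⟩
  simpa using (T.Bσ B).mul_mem (T.ι_mem_Bσ hx)
    (T.Hσ_le_Bσ hHB (T.mem_Hσ_of_fixes (T.fixes_basePt e)))

theorem coe_Bσ_eq_specialSet (hB : (B : Set G) = specialSet T.H T.σ) :
    (T.Bσ B : Set T.Gσ) = specialSet T.Hσ T.σbar := by
  have hHB : T.H ≤ B := SetLike.coe_subset_coe.1 (hB ▸ subset_specialSet)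
  ext g
  obtain ⟨x, e⟩ := T.exists_basePt_eq g
  rw [SetLike.mem_coe, T.mem_Bσ_iff hHB e, T.mem_specialSet_iff e, ← hB, SetLike.mem_coe]

/-- Write `h x = x (x⁻¹ h x)` and apply equivariance on either side: `σ(h) f(x) = f(x) σ(x⁻¹ h x)`.
-/
theorem apply_eq_zero_of_notMem {f : G → ℂ} (hf : f ∈ T.heckeAlgebra) {x : G}
    (hx : x ∉ specialSet T.H T.σ) : f x = 0 := by
  simp only [specialSet, Set.mem_ofPred_eq, not_forall] at hx
  obtain ⟨h, hh, hxh, hne⟩ := hx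
  have e1 := hf.2 ⟨h, hh⟩ 1 x
  have e2 := hf.2 1 ⟨_, hxh⟩ x
  simp only [OneMemClass.coe_one, one_mul, mul_one, map_one, Circle.coe_one] at e1 e2
  rw [show x * (x⁻¹ * h * x) = h * x by group, e1, mul_comm] at e2
  by_contra h0
  exact hne (Circle.ext (mul_left_cancel₀ h0 e2))

end HeckeTriple

/-! ### The corner attached to a character of a compact open subgroup -/

section CharacterCorner

variable {L : Type*} [TopologicalSpace L] [Group L] [IsTopologicalGroup L] [LocallyCompactSpace L]
  [MeasurableSpace L] [BorelSpace L] (M : Subgroup L) (hc : IsCompact (M : Set L))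
  (ho : IsOpen (M : Set L)) (ρ : M →* Circle) (hρ : Continuous ρ)

theorem extendByZero_mul_left {h : L} (hh : h ∈ M) (x : L) :
    extendByZero M ρ (h * x) = ρ ⟨h, hh⟩ * extendByZero M ρ x := by
  by_cases hx : x ∈ M
  · rw [extendByZero_of_mem M ρ hx, extendByZero_of_mem M ρ (M.mul_mem hh hx), ← Circle.coe_mul,
      ← map_mul]
    rfl
  · rw [extendByZero_of_notMem M ρ hx, extendByZero_of_notMem M ρ, mul_zero]
    rwa [M.mul_mem_cancel_left hh]

theorem extendByZero_mul_right {k : L} (hk : k ∈ M) (x : L) :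
    extendByZero M ρ (x * k) = extendByZero M ρ x * ρ ⟨k, hk⟩ := by
  by_cases hx : x ∈ M
  · rw [extendByZero_of_mem M ρ hx, extendByZero_of_mem M ρ (M.mul_mem hx hk), ← Circle.coe_mul,
      ← map_mul]
    rfl
  · rw [extendByZero_of_notMem M ρ hx, extendByZero_of_notMem M ρ, zero_mul]
    rwa [M.mul_mem_cancel_right hk]

theorem integral_indicator_normalizedHaar (c : ℂ) :
    ∫ y, (M : Set L).indicator (fun _ => c) y ∂(normalizedHaar M hc ho) = c := by
  rw [integral_indicator_const _ ho.measurableSet, Measure.real, normalizedHaar_self]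
  simp

theorem charProj_mul_apply_mul_left (a : ConvAlg (normalizedHaar M hc ho)) {h : L} (hh : h ∈ M)
    (x : L) : (charProj M hc ho ρ hρ * a) (h * x) =
      ρ ⟨h, hh⟩ * (charProj M hc ho ρ hρ * a) x := by
  rw [ConvAlg.mul_apply, ConvAlg.mul_apply, ← integral_const_mul,
    ← integral_mul_left_eq_self _ h]
  simp only [charProj_apply, extendByZero_mul_left M ρ hh, mul_inv_rev, mul_assoc,
    inv_mul_cancel_left]

theorem mul_charProj_apply_mul_right (a : ConvAlg (normalizedHaar M hc ho)) {k : L} (hk : k ∈ M)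
    (x : L) : (a * charProj M hc ho ρ hρ) (x * k) =
      (a * charProj M hc ho ρ hρ) x * ρ ⟨k, hk⟩ := by
  rw [ConvAlg.mul_apply, ConvAlg.mul_apply, ← integral_mul_const]
  simp only [charProj_apply, ← mul_assoc, extendByZero_mul_right M ρ hk]

/-- On `M` the convolution integrand is the constant `a x`, off `M` it is zero, and `M` has measure
1. -/
theorem charProj_mul_eq_self {a : ConvAlg (normalizedHaar M hc ho)}
    (ha : ∀ (h : M) x, a (h * x) = ρ h * a x) : charProj M hc ho ρ hρ * a = a := by
  refine ConvAlg.ext fun x => ?_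
  rw [ConvAlg.mul_apply]
  refine Eq.trans ?_ (integral_indicator_normalizedHaar M hc ho (a x))
  congr 1
  funext y
  rw [charProj_apply]
  by_cases hy : y ∈ M
  · rw [Set.indicator_of_mem (show y ∈ (M : Set L) from hy), extendByZero_of_mem M ρ hy]
    have := ha ⟨y, hy⟩ (y⁻¹ * x)
    rw [← this]
    simp
  · rw [Set.indicator_of_notMem (show y ∉ (M : Set L) from hy), extendByZero_of_notMem M ρ hy,
      zero_mul]

theorem mul_charProj_eq_self {a : ConvAlg (normalizedHaar M hc ho)}
    (ha : ∀ (k : M) x, a (x * k) = a x * ρ k) : a * charProj M hc ho ρ hρ = a := by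
  refine ConvAlg.ext fun x => ?_
  -- Substituting `x * y` for `y` turns the integrand into `a (x * y)` times the projection at
  -- `y⁻¹`; on `M` the factors `ρ y` and `ρ y⁻¹` cancel.
  rw [ConvAlg.mul_apply, ← integral_mul_left_eq_self _ x]
  refine Eq.trans ?_ (integral_indicator_normalizedHaar M hc ho (a x))
  congr 1
  funext y
  rw [charProj_apply, mul_inv_rev, inv_mul_cancel_right]
  by_cases hy : y ∈ M
  · rw [Set.indicator_of_mem (show y ∈ (M : Set L) from hy),
      extendByZero_of_mem M ρ (M.inv_mem hy), show x * y = x * (⟨y, hy⟩ : M) from rfl, ha,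
      show (⟨y⁻¹, M.inv_mem hy⟩ : M) = ⟨y, hy⟩⁻¹ from rfl, map_inv, mul_assoc, ← Circle.coe_mul,
      mul_inv_cancel, Circle.coe_one, mul_one]
  · rw [Set.indicator_of_notMem (show y ∉ (M : Set L) from hy), extendByZero_of_notMem M ρ,
      mul_zero]
    simpa using hy

/-- The corner of the projection given by a character `ρ` of `M` consists of the functions that
transform under `M`, on both sides, by `ρ`. -/
theorem mem_starCorner_charProj {a : ConvAlg (normalizedHaar M hc ho)} :
    a ∈ starCorner (charProj M hc ho ρ hρ) (isStarProjection_charProj M hc ho ρ hρ) ↔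
      ∀ (h k : M) x, a (h * x * k) = ρ h * a x * ρ k := by
  constructor
  · rintro ⟨a, rfl⟩ h k x
    rw [mul_charProj_apply_mul_right M hc ho ρ hρ _ k.2, mul_assoc _ a,
      charProj_mul_apply_mul_left M hc ho ρ hρ _ h.2]
  · intro ha
    refine ⟨a, ?_⟩
    rw [charProj_mul_eq_self M hc ho ρ hρ fun h x => ?_,
      mul_charProj_eq_self M hc ho ρ hρ fun k x => ?_]
    · simpa using ha 1 k x
    · simpa using ha h 1 x

end CharacterCorner

/-! ### The modular function as a quotient of indices -/

section ModularFunction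

variable {L : Type*} [TopologicalSpace L] [Group L] [IsTopologicalGroup L]
  [MeasurableSpace L] [BorelSpace L]

/-- `N` is the disjoint union of finitely many left translates of `N'`, one for each coset. -/
theorem measure_eq_relIndex_mul {N N' : Subgroup L} (hle : N' ≤ N) (hi : N'.relIndex N ≠ 0)
    (hm : MeasurableSet (N' : Set L)) (μ : Measure L) [μ.IsMulLeftInvariant] :
    μ N = N'.relIndex N * μ N' := by
  have : (N'.subgroupOf N).FiniteIndex := ⟨hi⟩
  have hU : (N : Set L) = ⋃ q : N ⧸ N'.subgroupOf N, (q.out : L) • (N' : Set L) := by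
    ext x
    simp only [SetLike.mem_coe, Set.mem_iUnion, Set.mem_smul_set_iff_inv_smul_mem, smul_eq_mul]
    constructor
    · intro hx
      refine ⟨((⟨x, hx⟩ : N) : N ⧸ N'.subgroupOf N), ?_⟩
      have := QuotientGroup.eq.1 (QuotientGroup.out_eq' ((⟨x, hx⟩ : N) : N ⧸ N'.subgroupOf N))
      exact this
    · rintro ⟨q, hq⟩
      simpa using N.mul_mem q.out.2 (hle hq)
  have hfin : Finite (N ⧸ N'.subgroupOf N) := inferInstance
  rw [hU, measure_iUnion]
  · simp only [measure_smul]
    rw [ENNReal.tsum_const, ENat.card_eq_coe_natCard]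
    rfl
  · intro p q hpq
    refine Set.disjoint_left.2 fun x hp hq => hpq ?_
    rw [Set.mem_smul_set_iff_inv_smul_mem] at hp hq
    rw [← QuotientGroup.out_eq' p, ← QuotientGroup.out_eq' q]
    refine QuotientGroup.eq.2 ?_
    have := N'.mul_mem hp (N'.inv_mem hq)
    rw [Subgroup.mem_subgroupOf]
    simpa using this
  · exact fun q => hm.const_smul _

variable [LocallyCompactSpace L]

/-- The preimage is `A x`, so this is the normalisation of `Δ`. On sets of compact closure two
left-invariant measures are proportional without any regularity assumption. -/
theorem measure_preimage_mul_inv_right (μ : Measure L) [μ.IsHaarMeasure] {A : Set L}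
    (hA : IsCompact A) (hcl : IsClosed A) (x : L) :
    μ.real ((fun y => y * x⁻¹) ⁻¹' A) = modularFun x * μ.real A := by
  have h := Measure.measure_isMulInvariant_eq_smul_of_isCompact_closure
    (Measure.map (· * x⁻¹) μ) μ (s := A) (by rwa [hcl.closure_eq])
  rw [Measure.map_apply (measurable_mul_const x⁻¹) hcl.measurableSet,
    ← Measure.modularCharacterFun_eq_haarScalarFactor μ] at h
  rw [Measure.real, h, Measure.real, ENNReal.smul_def, smul_eq_mul, ENNReal.toReal_mul]
  rfl

theorem isOpen_conjSubgroup {N : Subgroup L} (ho : IsOpen (N : Set L)) (x : L) :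
    IsOpen (conjSubgroup N x : Set L) := by
  have : (conjSubgroup N x : Set L) = (fun y => x⁻¹ * y * x) ⁻¹' N := by
    ext y; exact mem_conjSubgroup
  rw [this]
  exact ho.preimage (by fun_prop)

theorem heckeIndex_ne_zero_of_isCompact_of_isOpen {N : Subgroup L} (hc : IsCompact (N : Set L))
    (ho : IsOpen (N : Set L)) (x : L) : heckeIndex N x ≠ 0 := by
  have : CompactSpace N := isCompact_iff_compactSpace.1 hc
  have hopen : IsOpen ((conjSubgroup N x).subgroupOf N : Set N) :=
    (isOpen_conjSubgroup ho x).preimage continuous_subtype_val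
  have := Subgroup.quotient_finite_of_isOpen _ hopen
  rw [heckeIndex_eq]
  exact (Subgroup.finiteIndex_of_finite_quotient (H := (conjSubgroup N x).subgroupOf N)).index_ne_zero

/-- The modular function of a locally compact group in terms of a compact open subgroup. -/
theorem modularFun_eq_heckeModular {N : Subgroup L} (hc : IsCompact (N : Set L))
    (ho : IsOpen (N : Set L)) (x : L) : modularFun x = heckeModular N x := by
  let μ : Measure L := Measure.haar
  have hopen : ∀ z, IsOpen ((N ⊓ conjSubgroup N z : Subgroup L) : Set L) := fun z =>
    ho.inter (isOpen_conjSubgroup ho z)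
  have hcount : ∀ z, μ.real N = heckeIndex N z * μ.real (N ⊓ conjSubgroup N z : Subgroup L) := by
    intro z
    rw [Measure.real, measure_eq_relIndex_mul inf_le_left
      (heckeIndex_ne_zero_of_isCompact_of_isOpen hc ho z) (hopen z).measurableSet μ,
      ENNReal.toReal_mul, ENNReal.toReal_natCast]
    rfl
  have hpos : μ.real N ≠ 0 := by
    rw [Measure.real, ENNReal.toReal_ne_zero]
    exact ⟨(ho.measure_pos μ ⟨1, N.one_mem⟩).ne', hc.measure_lt_top.ne⟩
  -- Conjugation by `x⁻¹` carries `N ∩ x N x⁻¹` onto `N ∩ x⁻¹ N x`. Its left translation preserves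
  -- `μ`; its right translation by `x` multiplies `μ` by `Δ x`. Computing `μ N` from each
  -- intersection then gives `Δ x = L(x) / L(x⁻¹)`.
  have hconj : μ.real (N ⊓ conjSubgroup N x⁻¹ : Subgroup L) =
      modularFun x * μ.real (N ⊓ conjSubgroup N x : Subgroup L) := by
    have hset : ((N ⊓ conjSubgroup N x⁻¹ : Subgroup L) : Set L) = (fun y => y * x⁻¹) ⁻¹'
        ((fun y => x * y) ⁻¹' ((N ⊓ conjSubgroup N x : Subgroup L) : Set L)) := by
      ext y
      simp only [SetLike.mem_coe, Subgroup.mem_inf, mem_conjSubgroup, Set.mem_preimage, inv_inv]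
      rw [show x⁻¹ * (x * (y * x⁻¹)) * x = y by group, mul_assoc, and_comm]
    have hcl : IsClosed ((N ⊓ conjSubgroup N x : Subgroup L) : Set L) :=
      Subgroup.isClosed_of_isOpen _ (hopen x)
    have hcpt : IsCompact ((N ⊓ conjSubgroup N x : Subgroup L) : Set L) :=
      hc.of_isClosed_subset hcl inf_le_left
    rw [hset, measure_preimage_mul_inv_right μ
      (A := (fun y => x * y) ⁻¹' ((N ⊓ conjSubgroup N x : Subgroup L) : Set L))
      ((Homeomorph.mulLeft x).isCompact_preimage.2 hcpt) (hcl.preimage (by fun_prop)) x,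
      Measure.real, measure_preimage_mul, Measure.real]
  have h1 := hcount x
  have h2 := hcount x⁻¹
  rw [hconj] at h2
  have hi : (heckeIndex N x⁻¹ : ℝ) ≠ 0 :=
    Nat.cast_ne_zero.2 (heckeIndex_ne_zero_of_isCompact_of_isOpen hc ho _)
  have hm : μ.real (N ⊓ conjSubgroup N x : Subgroup L) ≠ 0 := by
    intro h0
    rw [h0, mul_zero] at h1
    exact hpos h1
  rw [heckeModular, eq_div_iff hi]
  refine mul_right_cancel₀ hm ?_
  rw [← h1, h2]
  ring

end ModularFunction

/-! ### Indices under passage to dense subgroups and along homomorphisms -/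

section IndexTransfer

/-- A dense subgroup of `N` meets all the cosets of an open subgroup. -/
theorem relIndex_eq_of_subset_closure {L : Type*} [TopologicalSpace L] [Group L]
    [IsTopologicalGroup L] {O D N : Subgroup L} (hO : IsOpen (O : Set L)) (hDN : D ≤ N)
    (hD : (N : Set L) ⊆ closure D) : O.relIndex D = O.relIndex N := by
  refine Nat.card_congr (Equiv.ofBijective (Subgroup.quotientSubgroupOfEmbeddingOfLE O hDN)
    ⟨(Subgroup.quotientSubgroupOfEmbeddingOfLE O hDN).injective, fun q => ?_⟩)
  obtain ⟨n, rfl⟩ := QuotientGroup.mk_surjective q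
  have hopen : IsOpen {y : L | (n : L)⁻¹ * y ∈ O} := hO.preimage (continuous_const_mul _)
  obtain ⟨d, hd, hdD⟩ := mem_closure_iff.1 (hD n.2) _ hopen (by simp [O.one_mem])
  refine ⟨((⟨d, hdD⟩ : D) : D ⧸ O.subgroupOf D), ?_⟩
  rw [Subgroup.quotientSubgroupOfEmbeddingOfLE_apply_mk, eq_comm, QuotientGroup.eq]
  exact hd

/-- Applied to `B → B_σ` and to `B → G`: the closure of `K` and `K` itself have the same preimage in
`B`, so their indices can be compared there. -/
theorem heckeIndex_comap {G' G : Type*} [Group G'] [Group G] (f : G' →* G) (N : Subgroup G)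
    (x : G') : heckeIndex (N.comap f) x =
      (conjSubgroup N (f x)).relIndex ((N.comap f).map f) := by
  rw [heckeIndex_eq, ← Subgroup.relIndex_comap]
  congr 1
  ext y
  simp [mem_conjSubgroup]

end IndexTransfer

/-! ### The orbit map of `B_σ` and integration over the cosets of `H_σ` -/

namespace HeckeTriple

variable {G : Type*} [Group G] (T : HeckeTriple G)

theorem mem_Hσ_iff {g : T.Gσ} {x : G}
    (e : (g : Equiv.Perm (G ⧸ T.K)) T.basePt = ((x : G) : G ⧸ T.K)) :
    g ∈ T.Hσ ↔ x ∈ T.H :=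
  ⟨fun hg => T.mem_H_of_mem_Hσ hg e, fun hx => T.mem_Hσ.2 ⟨⟨x, hx⟩, e⟩⟩

variable {T}

/-- As `σ` is trivial on `K`, `f` lives on `G/K`, where `G_σ` acts. -/
theorem apply_eq_of_mk_eq {f : G → ℂ} (hf : f ∈ T.heckeAlgebra) {x y : G}
    (e : (x : G ⧸ T.K) = y) : f x = f y := by
  obtain ⟨hH, h1⟩ := mem_charKer.1 (QuotientGroup.eq.1 e)
  have := hf.2 1 ⟨x⁻¹ * y, hH⟩ x
  simpa [h1] using this.symm

/-- The summands of the convolution in the Hecke algebra depend only on the left coset. -/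
theorem mul_apply_eq_of_mk_eq {f g : G → ℂ} (hf : f ∈ T.heckeAlgebra) (hg : g ∈ T.heckeAlgebra)
    (x : G) {y y' : G} (hy : (y : G ⧸ T.H) = y') :
    f y * g (y⁻¹ * x) = f y' * g (y'⁻¹ * x) := by
  obtain ⟨n, hn, rfl⟩ : ∃ n ∈ T.H, y' = y * n :=
    ⟨y⁻¹ * y', QuotientGroup.eq.1 hy, by simp⟩
  have e1 := hf.2 1 ⟨n, hn⟩ y
  have e2 := hg.2 (⟨n, hn⟩⁻¹) 1 (y⁻¹ * x)
  simp only [OneMemClass.coe_one, one_mul, mul_one, map_one, Circle.coe_one, map_inv,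
    InvMemClass.coe_inv] at e1 e2
  rw [e1, mul_inv_rev, mul_assoc n⁻¹, e2, Circle.coe_inv]
  field_simp [Circle.coe_ne_zero]

variable (T) (B : Subgroup G)

/-- The canonical homomorphism of `B` into `B_σ`. -/
noncomputable def ιB : B →* T.Bσ B :=
  (T.ι.comp B.subtype).codRestrict _ fun b => T.ι_mem_Bσ b.2

theorem coe_ιB (b : B) : (T.ιB B b : T.Gσ) = T.ι b := rfl

theorem denseRange_ιB : DenseRange (T.ιB B) := by
  intro g
  rw [closure_subtype, ← Set.range_comp]
  have hg : (g : T.Gσ) ∈ closure ((B.map T.ι : Subgroup T.Gσ) : Set T.Gσ) := g.2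
  convert hg using 2
  ext y
  simp [coe_ιB]

variable {B} in
/-- The action of `B_σ` on the base point of `G/K`. -/
noncomputable def orbitMap (b : T.Bσ B) : G ⧸ T.K :=
  ((b : T.Gσ) : Equiv.Perm (G ⧸ T.K)) T.basePt

variable {B} in
/-- The map of `B_σ` into `G/H` given by the action on the base point. -/
noncomputable def cosetMap (b : T.Bσ B) : G ⧸ T.H :=
  Subgroup.quotientMapOfLE T.K_le (T.orbitMap b)

variable {T B}

theorem cosetMap_eq {b : T.Bσ B} {x : G} (e : T.orbitMap b = (x : G ⧸ T.K)) :
    T.cosetMap b = (x : G ⧸ T.H) := by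
  rw [cosetMap, e, Subgroup.quotientMapOfLE_apply_mk]

theorem exists_orbitMap_eq (b : T.Bσ B) : ∃ x : G, T.orbitMap b = (x : G ⧸ T.K) :=
  T.exists_basePt_eq b

theorem isOpen_orbitMap (q : G ⧸ T.K) : IsOpen {b : T.Bσ B | T.orbitMap b = q} :=
  (T.isOpen_eval T.basePt q).preimage continuous_subtype_val

theorem isLocallyConstant_orbitMap : IsLocallyConstant (T.orbitMap : T.Bσ B → G ⧸ T.K) :=
  (IsLocallyConstant.iff_exists_open _).2 fun b =>
    ⟨_, isOpen_orbitMap (T.orbitMap b), rfl, fun _ h => h⟩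

theorem isOpen_cosetMap (q : G ⧸ T.H) : IsOpen {b : T.Bσ B | T.cosetMap b = q} :=
  (isLocallyConstant_orbitMap.comp (Subgroup.quotientMapOfLE T.K_le)).isOpen_fiber q

theorem orbitMap_ιB (x : B) : T.orbitMap (T.ιB B x) = ((x : G) : G ⧸ T.K) := T.ι_basePt x

/-- Elements of `B` approximate those of `B_σ` at two points of `G/K`. -/
theorem exists_ιB_eq (hHB : T.H ≤ B) (b : T.Bσ B) (q : G ⧸ T.K) :
    ∃ x : B, T.orbitMap b = ((x : G) : G ⧸ T.K) ∧
      ((b : T.Gσ) : Equiv.Perm (G ⧸ T.K)) q = (x : G) • q := by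
  obtain ⟨x, h1, h2⟩ := T.exists_ι_eq b T.basePt q
  have h1' : T.orbitMap b = (x : G ⧸ T.K) := h1.trans (T.ι_basePt x)
  exact ⟨⟨x, T.mem_of_mem_Bσ hHB b.2 h1'⟩, h1', h2⟩

/-- The orbit of a product depends on `b` at `yK`, not at the base point. Hence the two-point
approximation: an `x` from `exists_ιB_eq` agrees with `b` at both. -/
theorem orbitMap_mul {b b' : T.Bσ B} {x y : G} (hy : T.orbitMap b' = (y : G ⧸ T.K))
    (hx : ((b : T.Gσ) : Equiv.Perm (G ⧸ T.K)) (y : G ⧸ T.K) = x • (y : G ⧸ T.K)) :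
    T.orbitMap (b * b') = ((x * y : G) : G ⧸ T.K) := by
  change ((b : T.Gσ) : Equiv.Perm (G ⧸ T.K)) (T.orbitMap b') = _
  rw [hy, hx]
  rfl

theorem mem_HσB_iff {b : T.Bσ B} {x : G} (e : T.orbitMap b = (x : G ⧸ T.K)) :
    b ∈ T.HσB B ↔ x ∈ T.H :=
  T.mem_Hσ_iff e

theorem σB_eq {b : T.HσB B} {h : T.H} (e : T.orbitMap (b : T.Bσ B) = ((h : G) : G ⧸ T.K)) :
    T.σB B b = T.σ h :=
  T.σbar_eq b.2 e

theorem cosetMap_eq_iff {b : T.Bσ B} (x : B) :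
    T.cosetMap b = ((x : G) : G ⧸ T.H) ↔ (T.ιB B x)⁻¹ * b ∈ T.HσB B := by
  obtain ⟨y, hy⟩ := exists_orbitMap_eq b
  have e : T.orbitMap ((T.ιB B x)⁻¹ * b) = (((x : G)⁻¹ * y : G) : G ⧸ T.K) :=
    orbitMap_mul hy (by rw [← map_inv]; rfl)
  rw [cosetMap_eq hy, mem_HσB_iff e, eq_comm, QuotientGroup.eq]

theorem mem_of_cosetMap_eq (hHB : T.H ≤ B) {b : T.Bσ B} {x : G}
    (e : T.cosetMap b = (x : G ⧸ T.H)) : x ∈ B := by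
  obtain ⟨y, hy⟩ := exists_orbitMap_eq b
  rw [cosetMap_eq hy, QuotientGroup.eq] at e
  simpa using B.mul_mem (T.mem_of_mem_Bσ hHB b.2 hy) (hHB e)

theorem fiber_cosetMap_eq (x : B) : {b : T.Bσ B | T.cosetMap b = ((x : G) : G ⧸ T.H)} =
    (fun b => (T.ιB B x)⁻¹ * b) ⁻¹' (T.HσB B : Set (T.Bσ B)) := by
  ext b
  exact cosetMap_eq_iff x

theorem isCompact_fiber_cosetMap (hHB : T.H ≤ B) (q : G ⧸ T.H) :
    IsCompact {b : T.Bσ B | T.cosetMap b = q} := by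
  obtain ⟨x, rfl⟩ := QuotientGroup.mk_surjective q
  by_cases hx : x ∈ B
  · rw [fiber_cosetMap_eq ⟨x, hx⟩]
    exact (Homeomorph.mulLeft (T.ιB B ⟨x, hx⟩)⁻¹).isCompact_preimage.2 (T.isCompact_HσB B)
  · convert isCompact_empty
    exact Set.eq_empty_of_forall_notMem fun b hb => hx (mem_of_cosetMap_eq hHB hb)

theorem measure_fiber_cosetMap (x : B) :
    T.μB B {b : T.Bσ B | T.cosetMap b = ((x : G) : G ⧸ T.H)} = 1 := by
  rw [fiber_cosetMap_eq, measure_preimage_mul]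
  exact normalizedHaar_self _ _ _

/-- Turns the convolution integral into the sum over `G/H`. Fibres over cosets in `B` have measure
1; those over other cosets are empty, so `ψ` has to vanish there. -/
theorem integral_comp_cosetMap {ψ : G ⧸ T.H → ℂ} (hψ : (Function.support ψ).Finite)
    (hψB : ∀ x : G, ψ x ≠ 0 → x ∈ B) :
    ∫ b, ψ (T.cosetMap b) ∂(T.μB B) = ∑ᶠ q, ψ q := by
  have hfun : (fun b : T.Bσ B => ψ (T.cosetMap b)) = fun b => ∑ q ∈ hψ.toFinset,
      {b : T.Bσ B | T.cosetMap b = q}.indicator (fun _ => ψ q) b := by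
    funext b
    rw [Finset.sum_eq_single (T.cosetMap b)]
    · rw [Set.indicator_of_mem (by rfl)]
    · exact fun q _ hq => Set.indicator_of_notMem (fun h => hq (Eq.symm h)) _
    · intro h
      rw [Set.indicator_of_mem (by rfl)]
      simpa using h
  have hone : ∀ q ∈ hψ.toFinset, T.μB B {b : T.Bσ B | T.cosetMap b = q} = 1 := by
    intro q hq
    obtain ⟨x, rfl⟩ := QuotientGroup.mk_surjective q
    rw [Set.Finite.mem_toFinset] at hq
    exact measure_fiber_cosetMap ⟨x, hψB x hq⟩
  rw [hfun, integral_finsetSum, finsum_eq_sum_of_support_toFinset_subset ψ hψ subset_rfl]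
  · refine Finset.sum_congr rfl fun q hq => ?_
    rw [integral_indicator_const _ (isOpen_cosetMap q).measurableSet, Measure.real, hone q hq]
    simp
  · intro q hq
    refine (integrable_indicator_iff (isOpen_cosetMap q).measurableSet).2 ?_
    exact integrableOn_const (by rw [hone q hq]; exact ENNReal.one_ne_top)

/-! ### The modular function of `B_σ` -/

variable (T B) in
/-- The closure of `K` in `B_σ`: the stabiliser of the base point. -/
noncomputable def KσB : Subgroup (T.Bσ B) :=
  (MulAction.stabilizer (Equiv.Perm (G ⧸ T.K)) T.basePt).comap
    ((Subgroup.subtype _).comp (T.Bσ B).subtype)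

theorem mem_KσB {b : T.Bσ B} : b ∈ T.KσB B ↔ T.orbitMap b = T.basePt := Iff.rfl

theorem isOpen_KσB : IsOpen (T.KσB B : Set (T.Bσ B)) := isOpen_orbitMap T.basePt

theorem KσB_le : T.KσB B ≤ T.HσB B := fun _ hb => (mem_HσB_iff (mem_KσB.1 hb)).2 T.H.one_mem

theorem isCompact_KσB : IsCompact (T.KσB B : Set (T.Bσ B)) :=
  (T.isCompact_HσB B).of_isClosed_subset (Subgroup.isClosed_of_isOpen _ isOpen_KσB) KσB_le

theorem comap_ιB_KσB : (T.KσB B).comap (T.ιB B) = T.K.comap B.subtype := by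
  ext x
  rw [Subgroup.mem_comap, mem_KσB, orbitMap_ιB, eq_comm, QuotientGroup.eq,
    inv_one, one_mul]
  rfl

/-- The image of `B` is dense and `KσB` is open, so their intersection is dense in `KσB` and
computes the index of an open subgroup. Pulling back to `B` and pushing forward to `G` loses nothing
because `K ≤ B`. -/
theorem heckeIndex_KσB (hHB : T.H ≤ B) (x : B) :
    heckeIndex (T.KσB B) (T.ιB B x) = heckeIndex T.K (x : G) := by
  rw [heckeIndex_eq, ← relIndex_eq_of_subset_closure (isOpen_conjSubgroup isOpen_KσB _)
    (Subgroup.map_comap_le (T.ιB B) (T.KσB B)) ?_, ← heckeIndex_comap, comap_ιB_KσB,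
    heckeIndex_comap, heckeIndex_eq, Subgroup.map_comap_eq_self]
  · rfl
  · rw [Subgroup.range_subtype]
    exact T.K_le.trans hHB
  · intro b hb
    refine mem_closure_iff.2 fun U hU hbU => ?_
    obtain ⟨_, ⟨hyU, hy⟩, y, rfl⟩ := mem_closure_iff.1 (T.denseRange_ιB B b) _
      (hU.inter isOpen_KσB) ⟨hbU, hb⟩
    exact ⟨_, hyU, y, hy, rfl⟩

/-- `b` and `ιB x` differ by an element of a compact open subgroup, where the modular function is 1.
-/
theorem modularFun_eq_heckeModular_of_orbitMap_eq (hHB : T.H ≤ B) {b : T.Bσ B} {x : B}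
    (e : T.orbitMap b = ((x : G) : G ⧸ T.K)) : modularFun b = heckeModular T.K (x : G) := by
  have hk : (T.ιB B x)⁻¹ * b ∈ T.KσB B := T.fixes_basePt e
  have : modularFun b = modularFun (T.ιB B x * ((T.ιB B x)⁻¹ * b)) := by
    rw [mul_inv_cancel_left]
  rw [this, modularFun_mul, modularFun_eq_one_of_mem _ isCompact_KσB isOpen_KσB hk, mul_one,
    modularFun_eq_heckeModular isCompact_KσB isOpen_KσB, heckeModular, heckeModular,
    ← map_inv, heckeIndex_KσB hHB, heckeIndex_KσB hHB]
  rfl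

end HeckeTriple

/-! ### The isomorphism of the Hecke algebra with the corner -/

namespace HeckeTriple

variable {G : Type*} [Group G] {T : HeckeTriple G} {B : Subgroup G}

/-- The function on `B_σ` given by a function on `G/K`. -/
noncomputable def extendFun (B : Subgroup G) (f : G → ℂ) (b : T.Bσ B) : ℂ := f (T.orbitMap b).out

theorem extendFun_eq {f : G → ℂ} (hf : f ∈ T.heckeAlgebra) {b : T.Bσ B} {x : G}
    (e : T.orbitMap b = (x : G ⧸ T.K)) : extendFun B f b = f x :=
  apply_eq_of_mk_eq hf ((QuotientGroup.out_eq' _).trans e)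

theorem hasCompactSupport_extendFun (hHB : T.H ≤ B) {f : G → ℂ} (hf : f ∈ T.heckeAlgebra) :
    HasCompactSupport (extendFun B f : T.Bσ B → ℂ) := by
  refine HasCompactSupport.intro ((finite_image_mk hf).isCompact_biUnion
    fun q _ => isCompact_fiber_cosetMap (B := B) hHB q) fun b hb => ?_
  obtain ⟨x, hx⟩ := exists_orbitMap_eq b
  rw [extendFun_eq hf hx]
  by_contra h0
  exact hb (Set.mem_biUnion ⟨x, h0, rfl⟩ (cosetMap_eq hx))

/-- The element of `C_c(B_σ)` that extends an element of the generalised Hecke algebra. -/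
noncomputable def extend (hHB : T.H ≤ B) (f : T.heckeAlgebra) : ConvAlg (T.μB B) :=
  CompactlySupportedContinuousMap.mk
    ⟨extendFun B f, (isLocallyConstant_orbitMap.comp fun q => (f : G → ℂ) q.out).continuous⟩
    (hasCompactSupport_extendFun hHB f.2)

theorem extend_apply (hHB : T.H ≤ B) (f : T.heckeAlgebra) {b : T.Bσ B} {x : G}
    (e : T.orbitMap b = (x : G ⧸ T.K)) : extend hHB f b = (f : G → ℂ) x :=
  extendFun_eq f.2 e

theorem mem_corner {a : ConvAlg (T.μB B)} : a ∈ T.corner B ↔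
    ∀ (h k : T.HσB B) (b : T.Bσ B), a (h * b * k) = (T.σB B h : ℂ) * a b * (T.σB B k : ℂ) :=
  mem_starCorner_charProj _ _ _ _ _

theorem extend_mem_corner (hHB : T.H ≤ B) (f : T.heckeAlgebra) : extend hHB f ∈ T.corner B := by
  refine mem_corner.2 fun h k b => ?_
  obtain ⟨k', hk⟩ := exists_orbitMap_eq (k : T.Bσ B)
  -- Chosen from right to left, so that `h b k` sends the base point to `h' x k' K`, while `x` and
  -- `h'` still represent `b` and `h` at the base point.
  obtain ⟨x, hx, hxk⟩ := exists_ιB_eq hHB b (k' : G ⧸ T.K)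
  obtain ⟨h', hh, hhx⟩ := exists_ιB_eq hHB (h : T.Bσ B) (((x : G) * k' : G) : G ⧸ T.K)
  have hkH : k' ∈ T.H := (mem_HσB_iff hk).1 k.2
  have hhH : (h' : G) ∈ T.H := (mem_HσB_iff hh).1 h.2
  have e := orbitMap_mul (orbitMap_mul hk hxk) hhx
  rw [← mul_assoc, ← mul_assoc] at e
  rw [extend_apply hHB f e, extend_apply hHB f hx, σB_eq (b := h) (h := ⟨h', hhH⟩) hh,
    σB_eq (b := k) (h := ⟨k', hkH⟩) hk]
  exact f.2.2 ⟨h', hhH⟩ ⟨k', hkH⟩ x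

theorem extend_mul (hHB : T.H ≤ B) (hB : specialSet T.H T.σ ⊆ B) (f g : T.heckeAlgebra) :
    extend hHB (f * g) = extend hHB f * extend hHB g := by
  refine ConvAlg.ext fun b => ?_
  obtain ⟨x, hx⟩ := exists_orbitMap_eq b
  rw [extend_apply hHB _ hx, ConvAlg.mul_apply]
  have hint : ∀ y : T.Bσ B, extend hHB f y * extend hHB g (y⁻¹ * b) =
      (fun q : G ⧸ T.H => (f : G → ℂ) q.out * (g : G → ℂ) (q.out⁻¹ * x)) (T.cosetMap y) := by
    intro y
    obtain ⟨z, hz⟩ := exists_orbitMap_eq (y⁻¹ * b)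
    -- Agreement at `zK` gives `y' z K = xK`, so `y⁻¹ b` is represented by `y'⁻¹ x`, the argument of
    -- `g` in the Hecke convolution.
    obtain ⟨y', hy, hyz⟩ := exists_ιB_eq hHB y (z : G ⧸ T.K)
    have e := orbitMap_mul hz hyz
    rw [mul_inv_cancel_left, hx, QuotientGroup.eq] at e
    have ez : (z : G ⧸ T.K) = (((y' : G)⁻¹ * x : G) : G ⧸ T.K) := by
      rw [eq_comm, QuotientGroup.eq]
      simpa [mul_assoc] using e
    rw [extend_apply hHB f hy, extend_apply hHB g (hz.trans ez)]
    refine mul_apply_eq_of_mk_eq f.2 g.2 x ?_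
    rw [← cosetMap_eq hy]
    exact (QuotientGroup.out_eq' _).symm
  simp_rw [hint]
  refine (integral_comp_cosetMap (ψ := fun q : G ⧸ T.H =>
    (f : G → ℂ) q.out * (g : G → ℂ) (q.out⁻¹ * x)) ?_ ?_).symm
  · refine (finite_image_mk f.2).subset fun q hq => ⟨q.out, left_ne_zero_of_mul hq, ?_⟩
    exact QuotientGroup.out_eq' q
  · intro y hy
    by_contra hyB
    refine left_ne_zero_of_mul hy (apply_eq_zero_of_notMem T f.2 fun h => hyB ?_)
    have := QuotientGroup.eq.1 (QuotientGroup.out_eq' (y : G ⧸ T.H))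
    simpa using B.mul_mem (hB h) (hHB this)

theorem extend_star (hHB : T.H ≤ B) (f : T.heckeAlgebra) :
    extend hHB (star f) = star (extend hHB f) := by
  refine ConvAlg.ext fun b => ?_
  obtain ⟨z, hz⟩ := exists_orbitMap_eq b⁻¹
  -- Agreement at `zK` forces `x z K = K`, so `x` represents `b` and at the same time `x⁻¹`
  -- represents `b⁻¹`.
  obtain ⟨x, hx, hxz⟩ := exists_ιB_eq hHB b (z : G ⧸ T.K)
  have e := orbitMap_mul hz hxz
  rw [mul_inv_cancel, show T.orbitMap (1 : T.Bσ B) = ((1 : G) : G ⧸ T.K) from rfl,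
    QuotientGroup.eq, inv_one, one_mul] at e
  have hinv : T.orbitMap b⁻¹ = (((x⁻¹ : B) : G) : G ⧸ T.K) := by
    rw [hz, eq_comm, QuotientGroup.eq]
    simpa using e
  rw [extend_apply hHB _ hx, ConvAlg.star_apply, extend_apply hHB f hinv,
    modularFun_eq_heckeModular_of_orbitMap_eq hHB hinv]
  rfl

theorem extend_injective (hHB : T.H ≤ B) (hB : specialSet T.H T.σ ⊆ B) :
    Function.Injective (extend hHB : T.heckeAlgebra → ConvAlg (T.μB B)) := by
  intro f g hfg
  refine Subtype.ext (funext fun x => ?_)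
  by_cases hx : x ∈ B
  · rw [← extend_apply hHB f (orbitMap_ιB ⟨x, hx⟩), hfg, extend_apply hHB g (orbitMap_ιB ⟨x, hx⟩)]
  · rw [apply_eq_zero_of_notMem T f.2 fun h => hx (hB h),
      apply_eq_zero_of_notMem T g.2 fun h => hx (hB h)]

open Classical in
/-- The restriction to `B` of a function on `B_σ`, extended by zero to `G`. -/
noncomputable def restrictFun (a : T.Bσ B → ℂ) (x : G) : ℂ :=
  if h : x ∈ B then a (T.ιB B ⟨x, h⟩) else 0

theorem restrictFun_of_mem (a : T.Bσ B → ℂ) {x : G} (h : x ∈ B) :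
    restrictFun a x = a (T.ιB B ⟨x, h⟩) := dif_pos h

theorem restrictFun_of_notMem (a : T.Bσ B → ℂ) {x : G} (h : x ∉ B) : restrictFun a x = 0 :=
  dif_neg h

theorem restrictFun_mem (hHB : T.H ≤ B) {a : ConvAlg (T.μB B)} (ha : a ∈ T.corner B) :
    restrictFun a ∈ T.heckeAlgebra := by
  constructor
  -- The fibres of `cosetMap` are open, so the compact support meets only finitely many cosets of
  -- `H`, hence finitely many double cosets.
  · obtain ⟨t, ht⟩ := a.hasCompactSupport.isCompact.elim_finite_subcover
      (fun q : G ⧸ T.H => {b : T.Bσ B | T.cosetMap b = q}) isOpen_cosetMap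
      fun b _ => Set.mem_iUnion.2 ⟨T.cosetMap b, rfl⟩
    refine (t.finite_toSet.image fun q => DoubleCoset.mk T.H T.H q.out).subset ?_
    rintro _ ⟨x, hx, rfl⟩
    have hxB : x ∈ B := by
      by_contra h
      exact hx (restrictFun_of_notMem _ h)
    have hxs : T.ιB B ⟨x, hxB⟩ ∈ tsupport a := subset_tsupport _ fun h =>
      hx ((restrictFun_of_mem _ hxB).trans h)
    obtain ⟨q, hq, hxq⟩ := Set.mem_iUnion₂.1 (ht hxs)
    have hxq' : (x : G ⧸ T.H) = q := (cosetMap_eq (orbitMap_ιB ⟨x, hxB⟩)).symm.trans hxq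
    refine ⟨q, hq, ?_⟩
    obtain ⟨n, hn⟩ := QuotientGroup.mk_out_eq_mul T.H x
    rw [hxq'] at hn
    exact (DoubleCoset.eq _ _ _ _).2 ⟨1, T.H.one_mem, (n : G)⁻¹, T.H.inv_mem n.2, by simp [hn]⟩
  · intro h k x
    by_cases hx : x ∈ B
    · have hh : (h : G) ∈ B := hHB h.2
      have hk : (k : G) ∈ B := hHB k.2
      have hh' : T.ιB B ⟨h, hh⟩ ∈ T.HσB B := (mem_HσB_iff (orbitMap_ιB _)).2 h.2
      have hk' : T.ιB B ⟨k, hk⟩ ∈ T.HσB B := (mem_HσB_iff (orbitMap_ιB _)).2 k.2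
      have := mem_corner.1 ha ⟨_, hh'⟩ ⟨_, hk'⟩ (T.ιB B ⟨x, hx⟩)
      rw [σB_eq (h := h) (orbitMap_ιB _), σB_eq (h := k) (orbitMap_ιB _)] at this
      rw [restrictFun_of_mem _ (B.mul_mem (B.mul_mem hh hx) hk), restrictFun_of_mem _ hx, ← this]
      simp only [← map_mul]
      rfl
    · rw [restrictFun_of_notMem _ hx, restrictFun_of_notMem, mul_zero, zero_mul]
      rwa [B.mul_mem_cancel_right (hHB k.2), B.mul_mem_cancel_left (hHB h.2)]

theorem extend_restrictFun (hHB : T.H ≤ B) {a : ConvAlg (T.μB B)} (ha : a ∈ T.corner B) :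
    extend hHB ⟨restrictFun a, restrictFun_mem hHB ha⟩ = a := by
  refine ConvAlg.ext fun b => ?_
  obtain ⟨x, hx, -⟩ := exists_ιB_eq hHB b T.basePt
  rw [extend_apply hHB _ hx]
  have hk : (T.ιB B x)⁻¹ * b ∈ T.KσB B := T.fixes_basePt hx
  -- Here `b = ιB x * k` with `k` fixing the base point, where the extended character is 1, so
  -- equivariance of `a` gives `a b = a (ιB x)`.
  have := mem_corner.1 ha 1 ⟨_, KσB_le hk⟩ (T.ιB B x)
  rw [σB_eq (b := ⟨_, KσB_le hk⟩) (h := 1) (mem_KσB.1 hk)] at this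
  simp only [OneMemClass.coe_one, one_mul, mul_inv_cancel_left, map_one, Circle.coe_one,
    mul_one] at this
  rw [this]
  exact restrictFun_of_mem _ x.2

/-- The generalised Hecke algebra is isomorphic to the corner `p_σ C_c(B_σ) p_σ`. -/
noncomputable def heckeAlgebraEquivCorner (hHB : T.H ≤ B) (hB : specialSet T.H T.σ ⊆ B) :
    T.heckeAlgebra ≃⋆ₐ[ℂ] T.corner B where
  toEquiv := Equiv.ofBijective (fun f => ⟨extend hHB f, extend_mem_corner hHB f⟩)
    ⟨fun _ _ h => extend_injective hHB hB (congrArg Subtype.val h),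
      fun a => ⟨_, Subtype.ext (extend_restrictFun hHB a.2)⟩⟩
  map_mul' f g := Subtype.ext (extend_mul hHB hB f g)
  map_add' _ _ := rfl
  map_star' f := Subtype.ext (extend_star hHB f)
  map_smul' _ _ := rfl

end HeckeTriple

theorem proposition3p5 {G : Type*} [Group G] (T : HeckeTriple G) (hT : T.IsReduced)
    (B : Subgroup G) (hB : (B : Set G) = specialSet T.H T.σ) :
    (T.Bσ B : Set T.Gσ) = specialSet T.Hσ T.σbar ∧
      Nonempty (T.heckeAlgebra ≃⋆ₐ[ℂ] T.corner B) :=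
  ⟨T.coe_Bσ_eq_specialSet hB, ⟨HeckeTriple.heckeAlgebraEquivCorner
    (SetLike.coe_subset_coe.1 (hB ▸ HeckeTriple.subset_specialSet)) hB.ge⟩⟩
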